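/- Let $m,n\ge 0$, $\bar I=\{1,\dots,m+n\}$, $I=\{1,\dots,m+n-1\}$; put $|i|=0$ for $i\le m$, $|i|=1$ for $i>m$, and $s_i=(-1)^{|i|}$. On the complex vector space with basis $\epsilon_i$ ($i\in\bar I$) let $(\epsilon_i,\epsilon_j)=s_i\delta_{ij}$, and let $\alpha_i=\epsilon_i-\epsilon_{i+1}$ ($i\in I$). The super Yangian $\mathrm Y(\mathfrak{gl}_{m|n})$ is the unital associative $\mathbb C$-superalgebra generated by $t_{ij}^{(r)}$ ($i,j\in\bar I$, $r\ge1$), of parity $|i|+|j|$, with the relations, for $t_{ij}(u)=\delta_{ij}+\sum_{r\ge1}t_{ij}^{(r)}u^{-r}$, $$(u_1-u_2)[t_{ij}(u_1),t_{kl}(u_2)]=(-1)^{|i||j|+|i||k|+|j||k|}\big(t_{kj}(u_1)t_{il}(u_2)-t_{kj}(u_2)t_{il}(u_1)\big),$$ where $[\cdot,\cdot]$ is the supercommutator. Let $d_i(u)\in 1+u^{-1}\mathrm Y[[u^{-1}]]$ and $e_{ij}(u),f_{ji}(u)\in u^{-1}\mathrm Y[[u^{-1}]]$ ($i<j$) be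 the series given by the Gauss decomposition $$t_{ii}=d_i+\sum_{k<i}f_{ik}d_ke_{ki},\qquad t_{ij}=d_ie_{ij}+\sum_{k<i}f_{ik}d_ke_{kj},\qquad t_{ji}=f_{ji}d_i+\sum_{k<i}f_{jk}d_ke_{ki}\qquad(i<j),$$ and write $d_i(u)=1+\sum_{r\ge1}d_{i,r}u^{-r}$, $x_i^+(u)=e_{i,i+1}(u)=\sum_{r\ge1}x^+_{i,r}u^{-r}$ and $x_i^-(u)=f_{i+1,i}(u)=\sum_{r\ge1}x^-_{i,r}u^{-r}$ for $i\in I$. An $\ell$-weight is a tuple $\boldsymbol\zeta=(\zeta_i(u))_{i\in\bar I}$ with $\zeta_i(u)=1+\sum_{r\ge1}\zeta_{i,r}u^{-r}\in1+u^{-1}\mathbb C[[u^{-1}]]$; $\ell$-weights form an abelian group under componentwise multiplication. For $i\in I$ and $a\in\mathbb C$ let $A_{i,a}$ be the $\ell$-weight with $(A_{i,a})_j(u)=\dfrac{u-a}{u-a-(\alpha_i,\epsilon_j)}$. For a finite-dimensional module $V$ the generalized $\ell$-weight space $V_{\boldsymbol\zeta}$ is the set of all $v\in V$ with $(d_{i,r}-\zeta_{i,r})^{\dim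 V}v=0$ for all $i\in\bar I$, $r\ge1$. **Proposition.** Let $V$ be a finite-dimensional $\mathrm Y(\mathfrak{gl}_{m|n})$-module, $i\in I$, and fix a sign $\pm$. Let $\boldsymbol\mu,\boldsymbol\nu$ be $\ell$-weights such that $x_{i,j}^{\pm}(V_{\boldsymbol\mu})\cap V_{\boldsymbol\nu}\neq\{0\}$ for some $j\ge1$. Then there is $a\in\mathbb C$ such that 1. $\boldsymbol\nu=\boldsymbol\mu A_{i,a}^{\pm1}$ (with the same sign); 2. $V=V_{\boldsymbol\nu}\oplus\sum_{\boldsymbol\xi\ne\boldsymbol\nu}V_{\boldsymbol\xi}$, and there are bases $(v_k)_{1\le k\le\dim V_{\boldsymbol\mu}}$ of $V_{\boldsymbol\mu}$ and $(w_l)_{1\le l\le\dim V_{\boldsymbol\nu}}$ of $V_{\boldsymbol\nu}$, and complex polynomials $P_{k,l}$ of degree $\le k+l-2$, such that for all $k$ $$(x_i^{\pm}(z)v_k)_{\boldsymbol\nu}=\sum_{l=1}^{\dim V_{\boldsymbol\nu}}w_l\,P_{k,l}(\partial_z)\Big(\frac1{z-a}\Big)$$ as formal series in $z^{-1}$, where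 $1/(z-a)$ is expanded as $\sum_{r\ge1}a^{r-1}z^{-r}$ and $(\cdot)_{\boldsymbol\nu}$ denotes, coefficient by coefficient, the projection of $V$ onto $V_{\boldsymbol\nu}$ along the sum of the other generalized $\ell$-weight spaces. -/

import Mathlib

open scoped PowerSeries

noncomputable section

namespace SuperYangian

/-! Indices are counted from `0`: the index set `{1, …, m + n}` is `Fin (m + n)`, and the nodes
`1 ≤ i ≤ m + n - 1` are the natural numbers `i` with `i + 1 < m + n`. -/

/-! ### Parities, the weight space of the Cartan subalgebra, simple roots -/

/-- The parity `|i|`: even for the first `m` indices, odd for the last `n`. -/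
def par (m n : ℕ) (i : Fin (m + n)) : ℕ := if (i : ℕ) < m then 0 else 1

/-- The bilinear form on `𝔥*` with `(ε_i, ε_j) = s_i δ_{ij}`, where `s_i = (-1)^{|i|}`;
a weight is given by its coordinates in the basis `ε_i`. -/
def form (m n : ℕ) (x y : Fin (m + n) → ℂ) : ℂ := ∑ k, (-1) ^ par m n k * x k * y k

/-- The basis vector `ε_i` of `𝔥*`. -/
def eps (m n : ℕ) (i : Fin (m + n)) : Fin (m + n) → ℂ := Pi.single i 1

/-- The simple root `α_i = ε_i - ε_{i+1}`. -/
def simpleRoot (m n : ℕ) (i : ℕ) (hi : i + 1 < m + n) : Fin (m + n) → ℂ :=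
  eps m n ⟨i, i.lt_succ_self.trans hi⟩ - eps m n ⟨i + 1, hi⟩

/-! ### The super Yangian -/

/-- The free algebra on symbols `t_{ij}^{(r)}`, `r ≥ 1`; the triple `(i, j, r)` stands for
`t_{ij}^{(r + 1)}`. -/
abbrev FreeYangian (m n : ℕ) : Type := FreeAlgebra ℂ (Fin (m + n) × Fin (m + n) × ℕ)

/-- The coefficient of `u^{-r}` in `t_{ij}(u)`, at the level of the free algebra; the
coefficient of `u^0` is `δ_{ij}`. -/
def freeT (m n : ℕ) (i j : Fin (m + n)) : ℕ → FreeYangian m n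
  | 0 => if i = j then 1 else 0
  | r + 1 => FreeAlgebra.ι ℂ (i, j, r)

/-- The supercommutator `[t_{ij}^{(r)}, t_{kl}^{(s)}]` for the parities `|t_{ij}^{(r)}| = |i| + |j|`. -/
def freeComm (m n : ℕ) (i j k l : Fin (m + n)) (r s : ℕ) : FreeYangian m n :=
  freeT m n i j r * freeT m n k l s -
    (-1) ^ ((par m n i + par m n j) * (par m n k + par m n l)) *
      (freeT m n k l s * freeT m n i j r)

/-- The defining relations, the coefficients at `u₁^{-r} u₂^{-s}` of
`(u₁ - u₂) [t_{ij}(u₁), t_{kl}(u₂)] =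
  (-1)^{|i||j| + |i||k| + |j||k|} (t_{kj}(u₁) t_{il}(u₂) - t_{kj}(u₂) t_{il}(u₁))`.
(The remaining coefficients, those at `u₁ u₂^{-s}` and `u₁^{-r} u₂`, are supercommutators with
the scalar `δ`, and vanish.) -/
inductive Rel (m n : ℕ) : FreeYangian m n → FreeYangian m n → Prop
  | rtt (i j k l : Fin (m + n)) (r s : ℕ) :
      Rel m n
        (freeComm m n i j k l (r + 1) s - freeComm m n i j k l r (s + 1))
        ((-1) ^ (par m n i * par m n j + par m n i * par m n k + par m n j * par m n k) *
          (freeT m n k j r * freeT m n i l s - freeT m n k j s * freeT m n i l r))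

/-- The super Yangian `Y(gl_{m|n})`, as an associative unital algebra. -/
abbrev Yangian (m n : ℕ) : Type := RingQuot (Rel m n)

/-- The generating matrix `T(u) = (t_{ij}(u))`, a matrix of power series in `X = u^{-1}`. -/
def tSeries (m n : ℕ) (i j : Fin (m + n)) : (Yangian m n)⟦X⟧ :=
  PowerSeries.mk fun r => RingQuot.mkAlgHom ℂ (Rel m n) (freeT m n i j r)

/-! ### Gauss decomposition

Gaussian elimination for a matrix of power series over a ring that need not be commutative. -/

section Gauss

variable {N : ℕ} {R : Type*} [Ring R]

/-- The matrix left after eliminating the first `k` rows and columns (iterated Schur complement). -/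
def schur (T : Fin N → Fin N → R⟦X⟧) : ℕ → Fin N → Fin N → R⟦X⟧
  | 0 => T
  | k + 1 => fun i j =>
      if h : k < N then
        schur T k i j -
          schur T k i ⟨k, h⟩ * PowerSeries.invOfUnit (schur T k ⟨k, h⟩ ⟨k, h⟩) 1 *
            schur T k ⟨k, h⟩ j
      else schur T k i j

/-- The diagonal factor `d_i(u)`. -/
def gaussD (T : Fin N → Fin N → R⟦X⟧) (i : Fin N) : R⟦X⟧ := schur T i i i

/-- The upper unitriangular factor `e_{ij}(u)`, meant for `i < j`. -/
def gaussE (T : Fin N → Fin N → R⟦X⟧) (i j : Fin N) : R⟦X⟧ :=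
  PowerSeries.invOfUnit (schur T i i i) 1 * schur T i i j

/-- The lower unitriangular factor `f_{ji}(u)`, meant for `i < j`. -/
def gaussF (T : Fin N → Fin N → R⟦X⟧) (j i : Fin N) : R⟦X⟧ :=
  schur T i j i * PowerSeries.invOfUnit (schur T i i i) 1

theorem constantCoeff_schur (T : Fin N → Fin N → R⟦X⟧)
    (hT : ∀ i j, PowerSeries.constantCoeff (T i j) = if i = j then 1 else 0) (k : ℕ) :
    ∀ i j : Fin N, k ≤ i → k ≤ j →
      PowerSeries.constantCoeff (schur T k i j) = if i = j then 1 else 0 := by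
  induction k with
  | zero => intro i j _ _; exact hT i j
  | succ k ih =>
    intro i j hi hj
    have h : k < N := by omega
    have hik : i ≠ ⟨k, h⟩ := by rintro rfl; simp at hi
    simp only [schur, h, dif_pos, map_sub, map_mul]
    rw [ih i j (by omega) (by omega), ih i ⟨k, h⟩ (by omega) le_rfl]
    simp [hik]

theorem schur_diag_mul (T : Fin N → Fin N → R⟦X⟧)
    (hT : ∀ i j, PowerSeries.constantCoeff (T i j) = if i = j then 1 else 0) (i : Fin N) :
    schur T i i i * PowerSeries.invOfUnit (schur T i i i) 1 = 1 :=
  PowerSeries.mul_invOfUnit _ _ (by simpa using constantCoeff_schur T hT i i i le_rfl le_rfl)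

theorem schur_diag_mul' (T : Fin N → Fin N → R⟦X⟧)
    (hT : ∀ i j, PowerSeries.constantCoeff (T i j) = if i = j then 1 else 0) (i : Fin N) :
    PowerSeries.invOfUnit (schur T i i i) 1 * schur T i i i = 1 :=
  PowerSeries.invOfUnit_mul _ _ (by simpa using constantCoeff_schur T hT i i i le_rfl le_rfl)

theorem schur_eq (T : Fin N → Fin N → R⟦X⟧)
    (hT : ∀ i j, PowerSeries.constantCoeff (T i j) = if i = j then 1 else 0) (i j : Fin N)
    (k : ℕ) (hk : k ≤ N) :
    T i j = schur T k i j +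
      ∑ l ∈ Finset.univ.filter (fun l : Fin N => l.val < k), gaussF T i l * gaussD T l * gaussE T l j := by
  induction k with
  | zero => simp [schur]
  | succ k ih =>
    have h : k < N := hk
    have hset : (Finset.univ.filter fun l : Fin N => (l : ℕ) < k + 1) =
        insert ⟨k, h⟩ (Finset.univ.filter fun l : Fin N => (l : ℕ) < k) := by
      ext l
      simp [Fin.ext_iff]
      omega
    rw [ih h.le, hset, Finset.sum_insert (by simp)]
    have e : gaussF T i ⟨k, h⟩ * gaussD T ⟨k, h⟩ * gaussE T ⟨k, h⟩ j =
        schur T k i ⟨k, h⟩ * PowerSeries.invOfUnit (schur T k ⟨k, h⟩ ⟨k, h⟩) 1 *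
          schur T k ⟨k, h⟩ j := by
      have := schur_diag_mul' T hT ⟨k, h⟩
      simp only [gaussF, gaussD, gaussE]
      simp only [mul_assoc]
      simp only at this
      rw [← mul_assoc (PowerSeries.invOfUnit _ _) (schur T k ⟨k, h⟩ ⟨k, h⟩), this, one_mul]
    rw [e]
    simp only [schur, h, dif_pos]
    abel

/-- `t_{ii}(u) = d_i(u) + ∑_{k<i} f_{ik}(u) d_k(u) e_{ki}(u)`. -/
theorem gauss_diag (T : Fin N → Fin N → R⟦X⟧)
    (hT : ∀ i j, PowerSeries.constantCoeff (T i j) = if i = j then 1 else 0) (i : Fin N) :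
    T i i = gaussD T i + ∑ k : Fin N with k < i, gaussF T i k * gaussD T k * gaussE T k i :=
  schur_eq T hT i i i i.2.le

/-- `t_{ij}(u) = d_i(u) e_{ij}(u) + ∑_{k<i} f_{ik}(u) d_k(u) e_{kj}(u)`. -/
theorem gauss_upper (T : Fin N → Fin N → R⟦X⟧)
    (hT : ∀ i j, PowerSeries.constantCoeff (T i j) = if i = j then 1 else 0) (i j : Fin N) :
    T i j = gaussD T i * gaussE T i j +
      ∑ k : Fin N with k < i, gaussF T i k * gaussD T k * gaussE T k j := by
  rw [gaussD, gaussE, ← mul_assoc, schur_diag_mul T hT, one_mul]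
  exact schur_eq T hT i j i i.2.le

/-- `t_{ji}(u) = f_{ji}(u) d_i(u) + ∑_{k<i} f_{jk}(u) d_k(u) e_{ki}(u)`. -/
theorem gauss_lower (T : Fin N → Fin N → R⟦X⟧)
    (hT : ∀ i j, PowerSeries.constantCoeff (T i j) = if i = j then 1 else 0) (i j : Fin N) :
    T j i = gaussF T j i * gaussD T i +
      ∑ k : Fin N with k < i, gaussF T j k * gaussD T k * gaussE T k i := by
  rw [gaussD, gaussF, mul_assoc, schur_diag_mul' T hT, mul_one]
  exact schur_eq T hT j i i i.2.le

end Gauss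

/-- The matrix `T(u)` satisfies the hypothesis of the Gauss decomposition. -/
theorem constantCoeff_tSeries (m n : ℕ) (i j : Fin (m + n)) :
    PowerSeries.constantCoeff (tSeries m n i j) = if i = j then 1 else 0 := by
  rw [← PowerSeries.coeff_zero_eq_constantCoeff_apply, tSeries, PowerSeries.coeff_mk, freeT]
  split_ifs <;> simp

/-- `d_{i,r}`, the coefficient of `u^{-r}` in `d_i(u)`. -/
def d (m n : ℕ) (i : Fin (m + n)) (r : ℕ) : Yangian m n :=
  PowerSeries.coeff r (gaussD (tSeries m n) i)

/-- `x^±_{i,r}`, the coefficient of `u^{-r}` in `x_i^+(u) = e_{i,i+1}(u)` (sign `1`) or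
in `x_i^-(u) = f_{i+1,i}(u)` (sign `-1`). -/
def x (m n : ℕ) (σ : ℤˣ) (i : ℕ) (hi : i + 1 < m + n) (r : ℕ) : Yangian m n :=
  PowerSeries.coeff r
    (if σ = 1 then gaussE (tSeries m n) ⟨i, i.lt_succ_self.trans hi⟩ ⟨i + 1, hi⟩
      else gaussF (tSeries m n) ⟨i + 1, hi⟩ ⟨i, i.lt_succ_self.trans hi⟩)

/-! ### ℓ-weights -/

/-- The multiplicative group `1 + u^{-1} ℂ[[u^{-1}]]`. -/
abbrev EllSeries : Subgroup (ℂ⟦X⟧)ˣ :=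
  (Units.map (PowerSeries.constantCoeff (R := ℂ) : ℂ⟦X⟧ →* ℂ)).ker

/-- The group of ℓ-weights, with pointwise multiplication. -/
abbrev EllWeight (m n : ℕ) : Type := Fin (m + n) → EllSeries

/-- `ζ_{i,r}`, the coefficient of `u^{-r}` in `ζ_i(u)`. -/
def EllWeight.coeff {m n : ℕ} (ζ : EllWeight m n) (i : Fin (m + n)) (r : ℕ) : ℂ :=
  PowerSeries.coeff r ((ζ i : (ℂ⟦X⟧)ˣ) : ℂ⟦X⟧)

/-- The series `(u - c) / u = 1 - c u^{-1}`. -/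
def linearSeries (c : ℂ) : EllSeries :=
  ⟨{ val := 1 - PowerSeries.C c * PowerSeries.X
     inv := (1 - PowerSeries.C c * PowerSeries.X)⁻¹
     val_inv := PowerSeries.mul_inv_cancel _ (by simp)
     inv_val := PowerSeries.inv_mul_cancel _ (by simp) }, by
    rw [MonoidHom.mem_ker, Units.ext_iff]
    simp⟩

/-- The simple ℓ-root `A_{i,a}`: `(A_{i,a})_j(u) = (u - a) / (u - a - (α_i, ε_j))`. -/
def simpleEllRoot (m n : ℕ) (i : ℕ) (hi : i + 1 < m + n) (a : ℂ) : EllWeight m n := fun j =>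
  linearSeries a / linearSeries (a + form m n (simpleRoot m n i hi) (eps m n j))

section Module

variable {m n : ℕ} {V : Type*} [AddCommGroup V] [Module ℂ V]

/-- The generalized ℓ-weight space `V_ζ`, the set of all `v` with
`(d_{i,r} - ζ_{i,r})^{dim V} v = 0` for all `i` and all `r ≥ 1`. -/
def ellWeightSpace (ρ : Yangian m n →ₐ[ℂ] Module.End ℂ V) (ζ : EllWeight m n) : Submodule ℂ V :=
  ⨅ (i : Fin (m + n)) (r : ℕ),
    LinearMap.ker ((ρ (d m n i (r + 1)) - ζ.coeff i (r + 1) • (1 : Module.End ℂ V)) ^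
      Module.finrank ℂ V)

/-- The sum of all generalized ℓ-weight spaces other than `V_ζ`. -/
def ellWeightCompl (ρ : Yangian m n →ₐ[ℂ] Module.End ℂ V) (ζ : EllWeight m n) : Submodule ℂ V :=
  ⨆ (ξ : EllWeight m n) (_ : ξ ≠ ζ), ellWeightSpace ρ ξ

end Module

/-! ### Formal series in `z^{-1}` -/

/-- The operator `∂_z` on `ℂ[[z^{-1}]]`; in terms of `X = z^{-1}` it is `-X² d/dX`. -/
def dz : Module.End ℂ ℂ⟦X⟧ :=
  -(LinearMap.mulLeft ℂ (PowerSeries.X ^ 2) ∘ₗ (PowerSeries.derivative ℂ : ℂ⟦X⟧ →ₗ[ℂ] ℂ⟦X⟧))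

/-- The expansion `z^{-1} / (1 - a z^{-1})` of `1 / (z - a)` in powers of `z^{-1}`. -/
def pole (a : ℂ) : ℂ⟦X⟧ := PowerSeries.X * (1 - PowerSeries.C a * PowerSeries.X)⁻¹

end SuperYangian

end

noncomputable section

namespace SuperYangian

/-! ### The RTT relation in matrix form -/

section RMatrix

set_option linter.unusedSectionVars false

variable {ι A : Type*} [Fintype ι] [DecidableEq ι] [Ring A]

/-! The series `d_j(u)` commute with each other, and against `x_i^±` they satisfy `[d_{j,p+1}, x_s]
- [d_{j,p}, x_{s+1}] = c_j d_{j,p} x_s` for the sign `+`, with `x_s d_{j,p}` on the right for the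
sign `-`; here `c_j = ±(α_i, ε_j)`. Everything else is linear algebra.

Let `X_s : V_μ → V_ν` be the block of `x_{i,s+1}`. In the space of linear maps `V_μ → V_ν`, left and
right multiplications by the `d_{j,p}` commute and have a single eigenvalue each. Since `c_i = ±1`
(also when `α_i` is isotropic), the relations for `d_i` with `p = 0, 1` give `X_{s+1} = L X_s` with
a fixed operator `L` (`recursion_step`). Let `a` be its only eigenvalue. Substituted into the
relations for all `d_j`, the recursion yields operators with one eigenvalue that kill a nonzero
`X_s`, so that eigenvalue is `0` (`eigenvalue_relation`). This is the identity `ν_j(u) = μ_j(u)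
(A_{i,a}^{±1})_j(u)`, coefficient by coefficient.

Moreover `L = a + T` with `T Y = N Y - Y M` and `N`, `M` nilpotent. In bases where `M` is strictly
upper and `N` strictly lower triangular, the entry `(k, l)` of `T^q Y` vanishes for `q > k + l`
(indices from `0`). The binomial expansion of `(a + T)^s X_0` then gives derivatives of `1/(z - a)`
of order at most `k + l` (`exists_bases_poles`).

The relations themselves come from the RTT relation in `R`-matrix form. It is stable under passing
to submatrices and, up to the sign of its constant, to inverses. A Schur complement of `T(u)` is the
inverse of a corner of `T(u)⁻¹`, so it satisfies RTT again (`rtt_schurBlock`). This reduces the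
`d_k`, `e_{k,l}`, `f_{l,k}` to first rows and columns, and `d_{k+1}` to an inverted `2 × 2` block
(`gaussD_succ_rel`). -/

theorem sign_smul_congr {M : Type*} [AddCommGroup M] {a b : ℕ} (h : Even a ↔ Even b) (x : M) :
    (-1 : ℤ) ^ a • x = (-1 : ℤ) ^ b • x := by
  rw [neg_one_pow_congr h]

/-- `a ⊗ 1`. -/
def legOne (a : Matrix ι ι A) : Matrix (ι × ι) (ι × ι) A :=
  fun s t => if s.2 = t.2 then a s.1 t.1 else 0

/-- `1 ⊗ b`, with the signs of the super tensor product. -/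
def legTwo (p : ι → ℕ) (b : Matrix ι ι A) : Matrix (ι × ι) (ι × ι) A :=
  fun s t => if s.1 = t.1 then (-1 : ℤ) ^ (p s.1 * (p s.2 + p t.2)) • b s.2 t.2 else 0

/-- The super flip. -/
def superFlip (A : Type*) [Ring A] (p : ι → ℕ) : Matrix (ι × ι) (ι × ι) A :=
  fun s t => if s.1 = t.2 ∧ s.2 = t.1 then (-1 : ℤ) ^ (p s.1 * p s.2) • (1 : A) else 0

/-- The `R`-matrix `δ - lam P`. -/
def rMatrix (p : ι → ℕ) (δ lam : A) : Matrix (ι × ι) (ι × ι) A :=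
  Matrix.scalar _ δ - Matrix.scalar _ lam * superFlip A p

theorem legOne_mul (a b : Matrix ι ι A) : legOne (a * b) = legOne a * legOne b := by
  ext ⟨i, k⟩ ⟨j, l⟩
  simp only [legOne, Matrix.mul_apply, Fintype.sum_prod_type]
  simp

theorem legOne_one : legOne (1 : Matrix ι ι A) = 1 := by
  ext ⟨i, k⟩ ⟨j, l⟩
  by_cases h : i = j <;> by_cases h' : k = l <;> simp [legOne, Matrix.one_apply, h, h']

theorem legTwo_mul (p : ι → ℕ) (a b : Matrix ι ι A) :
    legTwo p (a * b) = legTwo p a * legTwo p b := by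
  ext ⟨i, k⟩ ⟨j, l⟩
  simp only [legTwo, Matrix.mul_apply, Fintype.sum_prod_type]
  by_cases h : i = j
  · subst h
    refine ((Finset.sum_eq_single i (by intro b _ hb; simp [hb.symm]) (by simp)).trans ?_).symm
    simp only [if_true, Finset.smul_sum, smul_mul_smul_comm, ← pow_add]
    refine Finset.sum_congr rfl fun q _ => sign_smul_congr ?_ _
    simp only [Nat.even_add, Nat.even_mul]; tauto
  · simp only [h, if_false]
    rw [eq_comm]
    refine Finset.sum_eq_zero fun x _ => Finset.sum_eq_zero fun y _ => ?_
    by_cases h1 : i = x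
    · subst h1; simp [h]
    · simp [h1]

theorem legTwo_one (p : ι → ℕ) : legTwo p (1 : Matrix ι ι A) = 1 := by
  ext ⟨i, k⟩ ⟨j, l⟩
  by_cases h : i = j <;> by_cases h' : k = l <;> simp [legTwo, Matrix.one_apply, h, h']

theorem superFlip_mul_apply (p : ι → ℕ) (m : Matrix (ι × ι) (ι × ι) A) (i k : ι) (t : ι × ι) :
    (superFlip A p * m) (i, k) t = (-1 : ℤ) ^ (p i * p k) • m (k, i) t := by
  simp only [Matrix.mul_apply, Fintype.sum_prod_type, superFlip]
  simp [ite_and, ite_mul]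

theorem mul_superFlip_apply (p : ι → ℕ) (m : Matrix (ι × ι) (ι × ι) A) (s : ι × ι) (j l : ι) :
    (m * superFlip A p) s (j, l) = (-1 : ℤ) ^ (p j * p l) • m s (l, j) := by
  simp only [Matrix.mul_apply, Fintype.sum_prod_type, superFlip]
  simp [ite_and, mul_ite, mul_comm (p l)]
  exact (Commute.neg_one_right _).pow_right _

theorem superFlip_mul_self (p : ι → ℕ) : superFlip A p * superFlip A p = 1 := by
  ext ⟨i, k⟩ ⟨j, l⟩
  rw [superFlip_mul_apply]
  by_cases h : i = j <;> by_cases h' : k = l <;>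
    simp [superFlip, Matrix.one_apply, h, h', mul_comm (p l)]
  rw [← pow_add, Even.neg_one_pow ⟨_, rfl⟩]

theorem superFlip_mul_legOne (p : ι → ℕ) (a : Matrix ι ι A) :
    superFlip A p * legOne a = legTwo p a * superFlip A p := by
  ext ⟨i, k⟩ ⟨j, l⟩
  rw [superFlip_mul_apply, mul_superFlip_apply]
  by_cases h : i = l
  · simp only [legOne, legTwo, h, if_true, smul_smul, ← pow_add]
    refine sign_smul_congr ?_ _
    simp only [Nat.even_add, Nat.even_mul]; tauto
  · simp [legOne, legTwo, h]

theorem superFlip_mul_legTwo (p : ι → ℕ) (a : Matrix ι ι A) :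
    superFlip A p * legTwo p a = legOne a * superFlip A p := by
  have h := congrArg (fun m => superFlip A p * m * superFlip A p) (superFlip_mul_legOne p a)
  simp only [mul_assoc, superFlip_mul_self, mul_one] at h
  rw [← mul_assoc, superFlip_mul_self, one_mul] at h
  exact h.symm

theorem scalar_commute {δ : A} (hδ : ∀ z, Commute δ z) {κ : Type*} [Fintype κ] [DecidableEq κ]
    (m : Matrix κ κ A) : Commute (Matrix.scalar κ δ) m :=
  Matrix.scalar_commute δ hδ m

theorem superFlip_mul_rMatrix (p : ι → ℕ) {δ lam : A} (hδ : ∀ z, Commute δ z)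
    (hl : ∀ z, Commute lam z) :
    superFlip A p * rMatrix p δ lam = rMatrix p δ lam * superFlip A p := by
  rw [rMatrix, mul_sub, sub_mul, (scalar_commute hδ _).eq, ← mul_assoc, (scalar_commute hl _).eq]

/-- The RTT relation between `a = T(u)` and `b = T(v)`; `δ` stands for `u - v`. -/
def RTTPair (p : ι → ℕ) (δ lam : A) (a b : Matrix ι ι A) : Prop :=
  ∀ i j k l, δ * (a i j * b k l - (-1 : ℤ) ^ ((p i + p j) * (p k + p l)) • (b k l * a i j)) =
    lam * (-1 : ℤ) ^ (p i * p j + p i * p k + p j * p k) • (a k j * b i l - b k j * a i l)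

theorem legOne_mul_legTwo_apply (p : ι → ℕ) (a b : Matrix ι ι A) (i j k l : ι) :
    (legOne a * legTwo p b) (i, k) (j, l) =
      (-1 : ℤ) ^ (p j * (p k + p l)) • (a i j * b k l) := by
  simp only [Matrix.mul_apply, Fintype.sum_prod_type, legOne, legTwo]
  simp [-zsmul_eq_mul]

theorem legTwo_mul_legOne_apply (p : ι → ℕ) (a b : Matrix ι ι A) (i j k l : ι) :
    (legTwo p b * legOne a) (i, k) (j, l) =
      (-1 : ℤ) ^ (p i * (p k + p l)) • (b k l * a i j) := by
  simp only [Matrix.mul_apply, Fintype.sum_prod_type, legOne, legTwo]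
  simp [ite_mul, -zsmul_eq_mul]

/-- Entry by entry, the two sides of `R T₁(u) T₂(v) = T₂(v) T₁(u) R` differ by the defect of the RTT
relation, up to the sign `(-1)^{|j|(|k| + |l|)}`. -/
theorem rttPair_iff (p : ι → ℕ) {δ lam : A} (hδ : ∀ z, Commute δ z) (hl : ∀ z, Commute lam z)
    (a b : Matrix ι ι A) :
    RTTPair p δ lam a b ↔
      rMatrix p δ lam * (legOne a * legTwo p b) = legTwo p b * legOne a * rMatrix p δ lam := by
  have key (i j k l : ι) :
      (rMatrix p δ lam * (legOne a * legTwo p b)) (i, k) (j, l) -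
        (legTwo p b * legOne a * rMatrix p δ lam) (i, k) (j, l) =
      (-1 : ℤ) ^ (p j * (p k + p l)) •
        (δ * (a i j * b k l - (-1 : ℤ) ^ ((p i + p j) * (p k + p l)) • (b k l * a i j)) -
        lam * (-1 : ℤ) ^ (p i * p j + p i * p k + p j * p k) •
          (a k j * b i l - b k j * a i l)) := by
    have e1 (m : Matrix (ι × ι) (ι × ι) A) (s t) :
        (Matrix.scalar (ι × ι) δ * m) s t = δ * m s t := by simp
    have e2 (m : Matrix (ι × ι) (ι × ι) A) (s t) :
        (Matrix.scalar (ι × ι) lam * m) s t = lam * m s t := by simp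
    rw [rMatrix, sub_mul, mul_sub, ← (scalar_commute hδ _).eq, ← mul_assoc _ _ (superFlip A p),
      ← (scalar_commute hl _).eq]
    simp only [mul_assoc (Matrix.scalar (ι × ι) lam)]
    simp only [Matrix.sub_apply, e1, e2, superFlip_mul_apply, mul_superFlip_apply,
      legOne_mul_legTwo_apply, legTwo_mul_legOne_apply, smul_sub, mul_sub, smul_smul,
      mul_smul_comm, ← pow_add]
    rw [sign_smul_congr (a := p j * (p k + p l) + (p i + p j) * (p k + p l))
        (b := p i * (p k + p l)) (by simp only [Nat.even_add, Nat.even_mul]; tauto),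
      sign_smul_congr (a := p i * p k + p j * (p i + p l))
        (b := p j * (p k + p l) + (p i * p j + p i * p k + p j * p k))
        (by simp only [Nat.even_add, Nat.even_mul]; tauto),
      sign_smul_congr (a := p j * p l + p i * (p k + p j))
        (b := p j * (p k + p l) + (p i * p j + p i * p k + p j * p k))
        (by simp only [Nat.even_add, Nat.even_mul]; tauto)]
    abel
  constructor
  · intro h
    ext ⟨i, k⟩ ⟨j, l⟩
    rw [← sub_eq_zero, key, h, sub_self, smul_zero]
  · intro h i j k l
    have := key i j k l
    rw [h, sub_self] at this
    have h2 := congrArg (fun z => (-1 : ℤ) ^ (p j * (p k + p l)) • z) this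
    simp only [smul_zero, smul_smul, ← pow_add, Even.neg_one_pow ⟨_, rfl⟩, one_smul] at h2
    exact sub_eq_zero.mp h2.symm

/-- Inverting both matrices exchanges the two spectral parameters. -/
theorem RTTPair.inverse {p : ι → ℕ} {δ lam : A} (hδ : ∀ z, Commute δ z)
    (hl : ∀ z, Commute lam z) {a b a' b' : Matrix ι ι A} (h : RTTPair p δ lam a b)
    (ha : a * a' = 1) (ha' : a' * a = 1) (hb : b * b' = 1) (hb' : b' * b = 1) :
    RTTPair p δ lam b' a' := by
  rw [rttPair_iff p hδ hl] at h ⊢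
  set R := rMatrix p δ lam
  set P := superFlip A p
  have hPP : P * P = 1 := superFlip_mul_self p
  have hPR : P * R = R * P := superFlip_mul_rMatrix p hδ hl
  have e1 : legOne a' * legTwo p b' * (legTwo p b * legOne a) = 1 := by
    rw [mul_assoc, ← mul_assoc (legTwo p b'), ← legTwo_mul, hb', legTwo_one, one_mul,
      ← legOne_mul, ha', legOne_one]
  have e2 : legOne a * legTwo p b * (legTwo p b' * legOne a') = 1 := by
    rw [mul_assoc, ← mul_assoc (legTwo p b), ← legTwo_mul, hb, legTwo_one, one_mul,
      ← legOne_mul, ha, legOne_one]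
  have e3 : legOne a' * legTwo p b' * R = R * (legTwo p b' * legOne a') := by
    calc legOne a' * legTwo p b' * R
        = legOne a' * legTwo p b' * (R * (legOne a * legTwo p b)) *
            (legTwo p b' * legOne a') := by
          rw [mul_assoc (_ * _) (R * _), mul_assoc R, e2, mul_one]
      _ = R * (legTwo p b' * legOne a') := by
          rw [h, ← mul_assoc (legOne a' * legTwo p b'), e1, one_mul]
  have c1 : P * (legOne a' * legTwo p b') = legTwo p a' * legOne b' * P := by
    rw [← mul_assoc, superFlip_mul_legOne, mul_assoc, superFlip_mul_legTwo, mul_assoc]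
  have c2 : P * (legTwo p b' * legOne a') = legOne b' * legTwo p a' * P := by
    rw [← mul_assoc, superFlip_mul_legTwo, mul_assoc, superFlip_mul_legOne, mul_assoc]
  -- Conjugation by the flip fixes `R` and interchanges the legs; this puts `b'` into the first leg.
  have e4 := congrArg (fun m => P * m * P) e3
  rw [← mul_assoc P _ R, ← mul_assoc P R, c1, hPR, mul_assoc R, c2, mul_assoc _ P R, hPR] at e4
  simp only [mul_assoc, hPP, mul_one] at e4
  simp only [mul_assoc]
  exact e4.symm

/-- Entries of `T(u)` and of the inverse of `T(v)` in disjoint rows and columns supercommute. -/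
theorem RTTPair.mixed {p : ι → ℕ} {δ lam : A} (hδ : ∀ z, Commute δ z)
    (hl : ∀ z, Commute lam z) {a b b' : Matrix ι ι A} (h : RTTPair p δ lam a b)
    (hb : b * b' = 1) (hb' : b' * b = 1) {i j k l : ι} (hkj : k ≠ j) (hil : i ≠ l) :
    δ * ((-1 : ℤ) ^ (p j * (p k + p l)) • (a i j * b' k l) -
      (-1 : ℤ) ^ (p i * (p k + p l)) • (b' k l * a i j)) = 0 := by
  rw [rttPair_iff p hδ hl] at h
  set R := rMatrix p δ lam with hR
  have e : legTwo p b' * R * legOne a = legOne a * R * legTwo p b' := by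
    have e1 : legTwo p b' * legTwo p b = 1 := by rw [← legTwo_mul, hb', legTwo_one]
    have e2 : legTwo p b * legTwo p b' = 1 := by rw [← legTwo_mul, hb, legTwo_one]
    calc legTwo p b' * R * legOne a
        = legTwo p b' * (R * (legOne a * legTwo p b)) * legTwo p b' := by
          simp only [mul_assoc, e2, mul_one]
      _ = _ := by
          rw [h]; simp only [← mul_assoc, e1, one_mul]
  have := congrFun (congrFun e (i, k)) (j, l)
  rw [hR, rMatrix, mul_sub, sub_mul, mul_sub, sub_mul, ← (scalar_commute hδ _).eq,
    ← (scalar_commute hδ _).eq, ← mul_assoc, ← mul_assoc, ← (scalar_commute hl _).eq,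
    ← (scalar_commute hl _).eq, mul_assoc, mul_assoc, mul_assoc, mul_assoc, mul_assoc] at this
  -- The flip moves both matrices into the same leg, where their product has an identity leg beside
  -- it; its entry vanishes because `i ≠ l`. The other term vanishes because `k ≠ j`.
  have z1 : (legTwo p b' * (superFlip A p * legOne a)) (i, k) (j, l) = 0 := by
    rw [superFlip_mul_legOne, ← mul_assoc, mul_superFlip_apply, ← legTwo_mul]
    simp [legTwo, hil]
  have z2 : (legOne a * (superFlip A p * legTwo p b')) (i, k) (j, l) = 0 := by
    rw [superFlip_mul_legTwo, ← mul_assoc, mul_superFlip_apply, ← legOne_mul]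
    simp [legOne, hkj]
  simp only [Matrix.sub_apply] at this
  simp only [Matrix.scalar_apply, Matrix.diagonal_mul, mul_assoc] at this
  rw [z1, z2, legOne_mul_legTwo_apply, legTwo_mul_legOne_apply] at this
  rw [mul_sub, sub_eq_zero]
  simpa using this.symm

end RMatrix

/-! ### Power series in two spectral parameters -/

section TwoVariables

variable {R : Type*} [Ring R]

/-- `f(u)` in `R[[u⁻¹, v⁻¹]]`, an iterated power series ring with outer variable `v⁻¹`. -/
def inU : R⟦X⟧ →+* R⟦X⟧⟦X⟧ := PowerSeries.C

/-- `f(v)` in `R[[u⁻¹, v⁻¹]]`. -/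
def inV : R⟦X⟧ →+* R⟦X⟧⟦X⟧ := PowerSeries.map PowerSeries.C

/-- The coefficient at `u^{-r} v^{-s}`. -/
def coeffTwo (r s : ℕ) (z : R⟦X⟧⟦X⟧) : R := PowerSeries.coeff r (PowerSeries.coeff s z)

/-- `v⁻¹ - u⁻¹ = (u - v) u⁻¹ v⁻¹`. -/
def diffUV (R : Type*) [Ring R] : R⟦X⟧⟦X⟧ := PowerSeries.X - inU PowerSeries.X

/-- `u⁻¹ v⁻¹`. -/
def prodUV (R : Type*) [Ring R] : R⟦X⟧⟦X⟧ := inU PowerSeries.X * PowerSeries.X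

theorem coeffTwo_ext {z w : R⟦X⟧⟦X⟧} (h : ∀ r s, coeffTwo r s z = coeffTwo r s w) : z = w := by
  ext s r; exact h r s

@[simp] theorem coeffTwo_sub (r s : ℕ) (z w : R⟦X⟧⟦X⟧) :
    coeffTwo r s (z - w) = coeffTwo r s z - coeffTwo r s w := by simp [coeffTwo]

@[simp] theorem coeffTwo_add (r s : ℕ) (z w : R⟦X⟧⟦X⟧) :
    coeffTwo r s (z + w) = coeffTwo r s z + coeffTwo r s w := by simp [coeffTwo]

@[simp] theorem coeffTwo_zero (r s : ℕ) : coeffTwo r s (0 : R⟦X⟧⟦X⟧) = 0 := by simp [coeffTwo]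

@[simp] theorem coeffTwo_zsmul (r s : ℕ) (n : ℤ) (z : R⟦X⟧⟦X⟧) :
    coeffTwo r s (n • z) = n • coeffTwo r s z := by simp [coeffTwo, -zsmul_eq_mul]

@[simp] theorem coeffTwo_inU_mul_inV (r s : ℕ) (f g : R⟦X⟧) :
    coeffTwo r s (inU f * inV g) = PowerSeries.coeff r f * PowerSeries.coeff s g := by
  simp [coeffTwo, inU, inV]

@[simp] theorem coeffTwo_inV_mul_inU (r s : ℕ) (f g : R⟦X⟧) :
    coeffTwo r s (inV g * inU f) = PowerSeries.coeff s g * PowerSeries.coeff r f := by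
  simp [coeffTwo, inU, inV]

theorem coeffTwo_inU_succ (r s : ℕ) (f : R⟦X⟧) : coeffTwo r (s + 1) (inU f) = 0 := by
  simp [coeffTwo, inU]

theorem X_commute_inner (f : R⟦X⟧) : Commute (PowerSeries.X : R⟦X⟧) f :=
  (PowerSeries.commute_X f).symm

theorem inU_X_commute (z : R⟦X⟧⟦X⟧) : Commute (inU PowerSeries.X) z := by
  refine PowerSeries.ext fun s => ?_
  simp [inU, (X_commute_inner _).eq]

theorem diffUV_commute (z : R⟦X⟧⟦X⟧) : Commute (diffUV R) z :=
  Commute.sub_left (PowerSeries.commute_X z).symm (inU_X_commute z)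

theorem prodUV_commute (z : R⟦X⟧⟦X⟧) : Commute (prodUV R) z :=
  Commute.mul_left (inU_X_commute z) (PowerSeries.commute_X z).symm

theorem coeffTwo_diffUV_mul_succ (r s : ℕ) (z : R⟦X⟧⟦X⟧) :
    coeffTwo (r + 1) (s + 1) (diffUV R * z) = coeffTwo (r + 1) s z - coeffTwo r (s + 1) z := by
  simp [coeffTwo, diffUV, inU, sub_mul, PowerSeries.coeff_succ_X_mul]

theorem coeffTwo_diffUV_mul_zero_succ (s : ℕ) (z : R⟦X⟧⟦X⟧) :
    coeffTwo 0 (s + 1) (diffUV R * z) = coeffTwo 0 s z := by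
  simp [coeffTwo, diffUV, inU, sub_mul, PowerSeries.coeff_succ_X_mul]

theorem coeffTwo_diffUV_mul_succ_zero (r : ℕ) (z : R⟦X⟧⟦X⟧) :
    coeffTwo (r + 1) 0 (diffUV R * z) = - coeffTwo r 0 z := by
  simp [coeffTwo, diffUV, inU, sub_mul, PowerSeries.coeff_succ_X_mul]

theorem coeffTwo_diffUV_mul_zero_zero (z : R⟦X⟧⟦X⟧) :
    coeffTwo 0 0 (diffUV R * z) = 0 := by
  simp [coeffTwo, diffUV, inU, sub_mul]

theorem coeffTwo_prodUV_mul_succ (r s : ℕ) (z : R⟦X⟧⟦X⟧) :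
    coeffTwo (r + 1) (s + 1) (prodUV R * z) = coeffTwo r s z := by
  simp [coeffTwo, prodUV, inU, mul_assoc, PowerSeries.coeff_succ_X_mul]

theorem coeffTwo_prodUV_mul_zero_left (s : ℕ) (z : R⟦X⟧⟦X⟧) :
    coeffTwo 0 s (prodUV R * z) = 0 := by
  simp [coeffTwo, prodUV, inU, mul_assoc]

theorem coeffTwo_prodUV_mul_zero_right (r : ℕ) (z : R⟦X⟧⟦X⟧) :
    coeffTwo r 0 (prodUV R * z) = 0 := by
  simp [coeffTwo, prodUV, inU, mul_assoc]

/-- `u - v - c` is not a zero divisor. -/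
theorem eq_zero_of_diffUV_mul (c : ℤ) {z : R⟦X⟧⟦X⟧} (h : diffUV R * z = prodUV R * c • z) :
    z = 0 := by
  refine coeffTwo_ext fun r => ?_
  -- Comparing coefficients at `u^{-r} v^{-(s+1)}` expresses `z_{r,s}` through the `z_{r-1,·}`, so
  -- the induction is on the exponent of `u⁻¹`, for all `s` together.
  induction r with
  | zero =>
    intro s
    have := congrArg (coeffTwo 0 (s + 1)) h
    rwa [coeffTwo_diffUV_mul_zero_succ, coeffTwo_prodUV_mul_zero_left, ← coeffTwo_zero 0 s] at this
  | succ r ih =>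
    intro s
    have := congrArg (coeffTwo (r + 1) (s + 1)) h
    rw [coeffTwo_diffUV_mul_succ, coeffTwo_prodUV_mul_succ, coeffTwo_zsmul, ih, ih] at this
    simpa using this

/-- The exchange of `u` and `v`. -/
def swapUV : R⟦X⟧⟦X⟧ →+* R⟦X⟧⟦X⟧ where
  toFun z := PowerSeries.mk fun s => PowerSeries.mk fun r => coeffTwo s r z
  map_one' := by
    refine coeffTwo_ext fun r s => ?_
    by_cases hr : r = 0 <;> by_cases hs : s = 0 <;>
      simp [coeffTwo, PowerSeries.coeff_one, hr, hs]
  map_zero' := by refine coeffTwo_ext fun r s => ?_; simp [coeffTwo]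
  map_add' z w := by refine coeffTwo_ext fun r s => ?_; simp [coeffTwo]
  map_mul' z w := by
    refine coeffTwo_ext fun r s => ?_
    simp only [coeffTwo, PowerSeries.coeff_mul, PowerSeries.coeff_mk, map_sum]
    exact Finset.sum_comm

theorem coeffTwo_swapUV (r s : ℕ) (z : R⟦X⟧⟦X⟧) : coeffTwo r s (swapUV z) = coeffTwo s r z := by
  simp [coeffTwo, swapUV]

theorem swapUV_inU (f : R⟦X⟧) : swapUV (inU f) = inV f := by
  refine coeffTwo_ext fun r s => ?_
  rw [coeffTwo_swapUV]
  by_cases hr : r = 0 <;> simp [coeffTwo, inU, inV, PowerSeries.coeff_C, hr]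

theorem swapUV_inV (f : R⟦X⟧) : swapUV (inV f) = inU f := by
  refine coeffTwo_ext fun r s => ?_
  rw [coeffTwo_swapUV]
  by_cases hr : s = 0 <;> simp [coeffTwo, inU, inV, PowerSeries.coeff_C, hr]

theorem inV_X : inV (PowerSeries.X : R⟦X⟧) = PowerSeries.X := by simp [inV]

theorem swapUV_diffUV : swapUV (diffUV R) = - diffUV R := by
  simp only [diffUV, ← inV_X, map_sub, swapUV_inU, swapUV_inV]; abel

theorem swapUV_prodUV : swapUV (prodUV R) = prodUV R := by
  simp only [prodUV, ← inV_X, map_mul, swapUV_inU, swapUV_inV]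
  rw [inV_X, (inU_X_commute _).eq]

/-- All coefficients of `f` commute with all coefficients of `g`. -/
def CoeffCommute (f g : R⟦X⟧) : Prop :=
  ∀ r s, Commute (PowerSeries.coeff r f) (PowerSeries.coeff s g)

theorem coeffCommute_iff {f g : R⟦X⟧} : CoeffCommute f g ↔ Commute (inU f) (inV g) := by
  constructor
  · intro h
    refine coeffTwo_ext fun r s => ?_
    simpa using (h r s).eq
  · intro h r s
    have := congrArg (coeffTwo r s) h.eq
    rwa [coeffTwo_inU_mul_inV, coeffTwo_inV_mul_inU] at this

theorem CoeffCommute.symm {f g : R⟦X⟧} (h : CoeffCommute f g) : CoeffCommute g f :=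
  fun r s => (h s r).symm

theorem CoeffCommute.mul_right {f g g' : R⟦X⟧} (h : CoeffCommute f g) (h' : CoeffCommute f g') :
    CoeffCommute f (g * g') := by
  rw [coeffCommute_iff] at *
  rw [map_mul]; exact h.mul_right h'

theorem commute_of_inverse {M : Type*} [Monoid M] {x y y' : M} (h : Commute x y)
    (h1 : y * y' = 1) (h2 : y' * y = 1) : Commute x y' := by
  let u : Mˣ := ⟨y, y', h1, h2⟩
  exact (show Commute x u from h).units_inv_right

theorem CoeffCommute.inverse_right {f g g' : R⟦X⟧} (h : CoeffCommute f g) (h1 : g * g' = 1)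
    (h2 : g' * g = 1) : CoeffCommute f g' := by
  rw [coeffCommute_iff] at *
  exact commute_of_inverse h (by rw [← map_mul, h1, map_one]) (by rw [← map_mul, h2, map_one])

/-- `(u - v) [d(u), e(v)] = c d(u) (e(v) - e(u))`. -/
def RaisingRel (c : ℤ) (d e : R⟦X⟧) : Prop :=
  diffUV R * (inU d * inV e - inV e * inU d) = prodUV R * c • (inU d * (inV e - inU e))

/-- `(u - v) [d(u), f(v)] = c (f(v) - f(u)) d(u)`. -/
def LoweringRel (c : ℤ) (d f : R⟦X⟧) : Prop :=
  diffUV R * (inU d * inV f - inV f * inU d) = prodUV R * c • ((inV f - inU f) * inU d)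

theorem RaisingRel.neg {c : ℤ} {d e : R⟦X⟧} (h : RaisingRel c d (-e)) : RaisingRel c d e := by
  have := congrArg Neg.neg h
  rw [← mul_neg, ← mul_neg, ← smul_neg] at this
  rw [RaisingRel]
  convert this using 3 <;> simp only [map_neg, mul_neg, neg_mul, mul_sub] <;> abel

theorem LoweringRel.neg {c : ℤ} {d f : R⟦X⟧} (h : LoweringRel c d (-f)) : LoweringRel c d f := by
  have := congrArg Neg.neg h
  rw [← mul_neg, ← mul_neg, ← smul_neg] at this
  rw [LoweringRel]
  convert this using 3 <;> simp only [map_neg, mul_neg, neg_mul, sub_mul] <;> abel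

theorem mul_commutator_mul {A : Type*} [Ring A] {d h e : A} (h1 : d * h = 1) (h2 : h * d = 1) :
    d * (h * e - e * h) * d = -(d * e - e * d) := by
  have e1 : d * (h * e - e * h) * d = (d * h) * (e * d) - d * e * (h * d) := by noncomm_ring
  rw [e1, h1, h2]; noncomm_ring

/-- With `h = d⁻¹` one has `d [h, e] d = -[d, e]`; multiplying by `d(u)` on both sides also cancels
the `h(u)` on the right and leaves a `d(u)` on the left, which exchanges the two types of relation.
-/
theorem LoweringRel.of_inverse {c : ℤ} {d h e : R⟦X⟧} (H : LoweringRel c h e) (h1 : d * h = 1)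
    (h2 : h * d = 1) : RaisingRel (-c) d e := by
  have h1' : inU d * inU h = 1 := by rw [← map_mul, h1, map_one]
  have h2' : inU h * inU d = 1 := by rw [← map_mul, h2, map_one]
  have := congrArg (fun z => -(inU d * z * inU d)) H
  simp only [(prodUV_commute _).eq, (diffUV_commute _).eq] at this
  simp only [← mul_assoc] at this
  simp only [mul_assoc _ _ (inU d), (prodUV_commute (inU d)).eq, (diffUV_commute (inU d)).eq] at this
  simp only [← mul_assoc, mul_commutator_mul h1' h2'] at this
  rw [mul_smul_comm, smul_mul_assoc, ← mul_assoc (inU d), mul_assoc _ _ (inU d), h2', mul_one,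
    neg_mul, neg_neg] at this
  rw [RaisingRel, (prodUV_commute _).eq, (diffUV_commute _).eq, this, neg_smul, neg_mul]

theorem RaisingRel.of_inverse {c : ℤ} {d h e : R⟦X⟧} (H : RaisingRel c h e) (h1 : d * h = 1)
    (h2 : h * d = 1) : LoweringRel (-c) d e := by
  have h1' : inU d * inU h = 1 := by rw [← map_mul, h1, map_one]
  have h2' : inU h * inU d = 1 := by rw [← map_mul, h2, map_one]
  have := congrArg (fun z => -(inU d * z * inU d)) H
  simp only [(prodUV_commute _).eq, (diffUV_commute _).eq] at this
  simp only [← mul_assoc] at this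
  simp only [mul_assoc _ _ (inU d), (prodUV_commute (inU d)).eq, (diffUV_commute (inU d)).eq] at this
  simp only [← mul_assoc, mul_commutator_mul h1' h2'] at this
  rw [mul_smul_comm, smul_mul_assoc, ← mul_assoc (inU d), h1', one_mul,
    neg_mul, neg_neg] at this
  rw [LoweringRel, (prodUV_commute _).eq, (diffUV_commute _).eq, this, neg_smul, neg_mul]

theorem RaisingRel.coeff {c : ℤ} {d e : R⟦X⟧} (H : RaisingRel c d e) (r s : ℕ) :
    PowerSeries.coeff (r + 1) d * PowerSeries.coeff (s + 1) e -
      PowerSeries.coeff (s + 1) e * PowerSeries.coeff (r + 1) d -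
      (PowerSeries.coeff r d * PowerSeries.coeff (s + 2) e -
      PowerSeries.coeff (s + 2) e * PowerSeries.coeff r d) =
    c • (PowerSeries.coeff r d * PowerSeries.coeff (s + 1) e) := by
  -- The term `d(u) e(u)` is free of `v`, so it does not contribute to a coefficient with positive
  -- exponent of `v⁻¹`.
  have := congrArg (coeffTwo (r + 1) (s + 2)) H
  rw [coeffTwo_diffUV_mul_succ, coeffTwo_prodUV_mul_succ, mul_sub, ← map_mul inU] at this
  simpa only [coeffTwo_sub, coeffTwo_zsmul, coeffTwo_inU_mul_inV, coeffTwo_inV_mul_inU,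
    coeffTwo_inU_succ, sub_zero] using this

theorem LoweringRel.coeff {c : ℤ} {d e : R⟦X⟧} (H : LoweringRel c d e) (r s : ℕ) :
    PowerSeries.coeff (r + 1) d * PowerSeries.coeff (s + 1) e -
      PowerSeries.coeff (s + 1) e * PowerSeries.coeff (r + 1) d -
      (PowerSeries.coeff r d * PowerSeries.coeff (s + 2) e -
      PowerSeries.coeff (s + 2) e * PowerSeries.coeff r d) =
    c • (PowerSeries.coeff (s + 1) e * PowerSeries.coeff r d) := by
  have := congrArg (coeffTwo (r + 1) (s + 2)) H
  rw [coeffTwo_diffUV_mul_succ, coeffTwo_prodUV_mul_succ, sub_mul, ← map_mul inU] at this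
  simpa only [coeffTwo_sub, coeffTwo_zsmul, coeffTwo_inU_mul_inV, coeffTwo_inV_mul_inU,
    coeffTwo_inU_succ, sub_zero] using this

theorem CoeffCommute.raisingRel {d e : R⟦X⟧} (h : CoeffCommute d e) : RaisingRel 0 d e := by
  rw [coeffCommute_iff] at h
  simp [RaisingRel, h.eq]

theorem CoeffCommute.loweringRel {d e : R⟦X⟧} (h : CoeffCommute d e) : LoweringRel 0 d e := by
  rw [coeffCommute_iff] at h
  simp [LoweringRel, h.eq]

end TwoVariables

/-! ### Matrices of series with the RTT relation -/

section RTT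

variable {ι R : Type*} [Fintype ι] [DecidableEq ι] [Ring R]

set_option linter.unusedSectionVars false

/-- The RTT relation `(u - v) [t_{ij}(u), t_{kl}(v)] = ± c (t_{kj}(u) t_{il}(v) - t_{kj}(v) t_{il}(u))`
for a matrix of series. -/
def RTT (p : ι → ℕ) (c : ℤ) (T : Matrix ι ι R⟦X⟧) : Prop :=
  RTTPair p (diffUV R) (c • prodUV R) (inU.mapMatrix T) (inV.mapMatrix T)

theorem RTT.submatrix {κ : Type*} [Fintype κ] [DecidableEq κ] {p : ι → ℕ} {c : ℤ}
    {T : Matrix ι ι R⟦X⟧} (h : RTT p c T) (g : κ → ι) : RTT (p ∘ g) c (T.submatrix g g) :=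
  fun i j k l => h (g i) (g j) (g k) (g l)

theorem zsmul_prodUV_commute (c : ℤ) (z : R⟦X⟧⟦X⟧) : Commute (c • prodUV R) z :=
  (prodUV_commute z).smul_left c

theorem RTT.inverse {p : ι → ℕ} {c : ℤ} {T T' : Matrix ι ι R⟦X⟧} (h : RTT p c T)
    (h1 : T * T' = 1) (h2 : T' * T = 1) : RTT p (-c) T' := by
  have m1 (φ : R⟦X⟧ →+* R⟦X⟧⟦X⟧) : φ.mapMatrix T * φ.mapMatrix T' = 1 := by
    rw [← map_mul, h1, map_one]
  have m2 (φ : R⟦X⟧ →+* R⟦X⟧⟦X⟧) : φ.mapMatrix T' * φ.mapMatrix T = 1 := by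
    rw [← map_mul, h2, map_one]
  have H := RTTPair.inverse diffUV_commute (zsmul_prodUV_commute c) h (m1 _) (m2 _) (m1 _) (m2 _)
  -- The inverses satisfy RTT with `u` and `v` interchanged. Renaming the variables changes the sign
  -- of `u - v`, hence that of `c`.
  intro i j k l
  have := congrArg (fun z => -(swapUV z)) (H i j k l)
  simp only [RingHom.mapMatrix_apply, Matrix.map_apply, map_mul, map_sub, map_zsmul, swapUV_inU,
    swapUV_inV, swapUV_diffUV, swapUV_prodUV] at this ⊢
  simpa only [neg_mul, neg_neg, map_pow, map_neg, map_one, Int.cast_neg, neg_smul] using this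

/-- Here the right side of RTT is itself a multiple of the commutator, which is therefore killed by
some `u - v - c'` with `c'` an integer. -/
theorem RTT.coeffCommute_diag {p : ι → ℕ} {c : ℤ} {T : Matrix ι ι R⟦X⟧} (h : RTT p c T) (o : ι) :
    CoeffCommute (T o o) (T o o) := by
  rw [coeffCommute_iff, Commute, SemiconjBy, ← sub_eq_zero]
  have := h o o o o
  apply eq_zero_of_diffUV_mul (c * (-1) ^ (p o * p o + p o * p o + p o * p o))
  rw [Even.neg_one_pow (by simp [parity_simps]), one_smul] at this
  simp only [RingHom.mapMatrix_apply, Matrix.map_apply] at this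
  rw [this, smul_mul_assoc, mul_smul, mul_smul_comm c]

theorem sign_cube (a : ℕ) : (-1 : ℤ) ^ (a * a + a * a + a * a) = (-1) ^ a :=
  neg_one_pow_congr (by simp only [Nat.even_add, Nat.even_mul]; tauto)

theorem cancel_left_of_central {A : Type*} [Ring A] {δ l x y ex ey y' : A} (ε : ℤ)
    (hδ : Commute δ y) (hl : Commute l y) (hc : x * y = y * x) (hy : y' * y = 1)
    (H : δ * (x * (y * ey) - y * ey * x) = l * ε • (x * (y * ey) - y * (x * ex))) :
    δ * (x * ey - ey * x) = l * ε • (x * (ey - ex)) := by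
  have e1 : x * (y * ey) - y * ey * x = y * (x * ey - ey * x) := by
    rw [← mul_assoc, hc]; noncomm_ring
  have e2 : x * (y * ey) - y * (x * ex) = y * (x * (ey - ex)) := by
    rw [← mul_assoc, hc]; noncomm_ring
  rw [e1, e2, ← mul_assoc, hδ.eq, ← mul_smul_comm, ← mul_assoc, hl.eq] at H
  simpa only [← mul_assoc, hy, one_mul] using congrArg (fun z => y' * z) H

theorem cancel_right_of_central {A : Type*} [Ring A] {δ l x y fx fy y' : A} (ε : ℤ)
    (hc : x * y = y * x) (hy : y * y' = 1)
    (H : δ * (x * (fy * y) - fy * y * x) = l * ε • (fx * x * y - fy * y * x)) :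
    δ * (x * fy - fy * x) = l * ε • ((fx - fy) * x) := by
  have e1 : x * (fy * y) - fy * y * x = (x * fy - fy * x) * y := by
    rw [mul_assoc fy, ← hc]; noncomm_ring
  have e2 : fx * x * y - fy * y * x = (fx - fy) * x * y := by
    rw [mul_assoc fy, ← hc]; noncomm_ring
  rw [e1, e2, ← smul_mul_assoc] at H
  simpa only [mul_assoc, hy, mul_one] using congrArg (fun z => z * y') H

/-- The relation of `t_{oo}(u)` with `t_{oj}(v) = t_{oo}(v) e(v)`: as `t_{oo}(v)` commutes with
`t_{oo}(u)`, it can be cancelled on the left. -/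
theorem RTT.raisingRel {p : ι → ℕ} {c : ℤ} {T : Matrix ι ι R⟦X⟧} (h : RTT p c T) {o j : ι}
    {d' e : R⟦X⟧} (hd : d' * T o o = 1) (he : T o j = T o o * e) :
    RaisingRel (c * (-1) ^ p o) (T o o) e := by
  have H := h o o o j
  rw [sign_cube, Even.neg_one_pow (by simp [parity_simps]), one_smul] at H
  simp only [RingHom.mapMatrix_apply, Matrix.map_apply, he, map_mul] at H
  have := cancel_left_of_central _ (diffUV_commute _) (zsmul_prodUV_commute c _)
    (coeffCommute_iff.1 (h.coeffCommute_diag o)).eq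
    (by rw [← map_mul, hd, map_one] : inV d' * inV (T o o) = 1) H
  rw [RaisingRel, this, smul_mul_assoc, mul_smul, mul_smul_comm c]

theorem RTT.loweringRel {p : ι → ℕ} {c : ℤ} {T : Matrix ι ι R⟦X⟧} (h : RTT p c T) {o j : ι}
    {d' f : R⟦X⟧} (hd : T o o * d' = 1) (hf : T j o = f * T o o) :
    LoweringRel (-(c * (-1) ^ p o)) (T o o) f := by
  have H := h o o j o
  rw [sign_smul_congr (a := p o * p o + p o * p j + p o * p j) (b := p o)
    (by simp only [Nat.even_add, Nat.even_mul]; tauto),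
    Even.neg_one_pow (by simp [parity_simps]), one_smul] at H
  simp only [RingHom.mapMatrix_apply, Matrix.map_apply, hf, map_mul] at H
  have := cancel_right_of_central _
    (coeffCommute_iff.1 (h.coeffCommute_diag o)).eq
    (by rw [← map_mul, hd, map_one] : inV (T o o) * inV d' = 1) H
  rw [LoweringRel, this, smul_mul_assoc, neg_smul, mul_smul, mul_neg, mul_smul_comm c,
    ← smul_neg, ← mul_neg, ← smul_neg, ← neg_mul, neg_sub]

/-- Entries of `T(u)` and of the inverse of `T(v)` in disjoint rows and columns. -/
theorem RTT.mixed {p : ι → ℕ} {c : ℤ} {T T' : Matrix ι ι R⟦X⟧} (h : RTT p c T)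
    (h1 : T * T' = 1) (h2 : T' * T = 1) {i j k l : ι} (hkj : k ≠ j) (hil : i ≠ l) :
    (-1 : ℤ) ^ ((p i + p j) * p k) • (inU (T i j) * inV (T' k l)) =
      (-1 : ℤ) ^ ((p i + p j) * p l) • (inV (T' k l) * inU (T i j)) := by
  have H := RTTPair.mixed (b' := inV.mapMatrix T') diffUV_commute (zsmul_prodUV_commute c) h
    (by rw [← map_mul, h1, map_one]) (by rw [← map_mul, h2, map_one]) hkj hil
  have H := eq_zero_of_diffUV_mul 0 (H.trans (by rw [zero_smul, mul_zero]))
  rw [sub_eq_zero] at H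
  have H := congrArg (fun z => (-1 : ℤ) ^ (p j * p l + p i * p k) • z) H
  simp only [smul_smul, ← pow_add, RingHom.mapMatrix_apply, Matrix.map_apply] at H
  convert H using 1 <;> refine sign_smul_congr ?_ _ <;>
    simp only [Nat.even_add, Nat.even_mul] <;> tauto

/-- Twisted commutation with a matrix passes to the inverse matrix. -/
theorem twisted_commute_inverse {A : Type*} [Ring A] {M M' : Matrix ι ι A} (h1 : M * M' = 1)
    (h2 : M' * M = 1) (η : ι → ℤ) (a : A)
    (h : ∀ k l, η k • (a * M k l) = η l • (M k l * a)) (k l : ι) :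
    η k • (a * M' k l) = η l • (M' k l * a) := by
  -- The twist is absorbed into a diagonal matrix that commutes with `M`, hence with its inverse.
  have hU : Commute (Matrix.diagonal fun i => η i • a) M := by
    ext k l
    simpa [-zsmul_eq_mul, smul_mul_assoc, mul_smul_comm] using h k l
  have := congrFun (congrFun (commute_of_inverse hU h1 h2).eq k) l
  simpa [-zsmul_eq_mul, smul_mul_assoc, mul_smul_comm] using this

end RTT

/-! ### Inverses of matrices of series -/

section MatrixInverse

variable {ι R : Type*} [Fintype ι] [DecidableEq ι] [Ring R]

/-- Series of matrices as matrices of series. -/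
def matrixOfSeries : (Matrix ι ι R)⟦X⟧ →* Matrix ι ι R⟦X⟧ where
  toFun F := Matrix.of fun i j => PowerSeries.mk fun r => PowerSeries.coeff r F i j
  map_one' := by
    ext i j r
    by_cases h : i = j <;> by_cases h' : r = 0 <;>
      simp [PowerSeries.coeff_one, Matrix.one_apply, h, h']
  map_mul' F G := by
    ext i j r
    simp only [Matrix.mul_apply, Matrix.of_apply, map_sum, PowerSeries.coeff_mk,
      PowerSeries.coeff_mul, Matrix.sum_apply]
    exact Finset.sum_comm

/-- Read as a series with matrix coefficients, `T` has constant term `1`. -/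
theorem exists_matrix_inverse (T : Matrix ι ι R⟦X⟧)
    (hT : ∀ i j, PowerSeries.constantCoeff (T i j) = if i = j then 1 else 0) :
    ∃ T' : Matrix ι ι R⟦X⟧, T * T' = 1 ∧ T' * T = 1 := by
  let F : (Matrix ι ι R)⟦X⟧ := PowerSeries.mk fun r => Matrix.of fun i j => PowerSeries.coeff r (T i j)
  have hF : matrixOfSeries F = T := by
    refine Matrix.ext fun i j => PowerSeries.ext fun r => ?_
    change PowerSeries.coeff r (PowerSeries.mk fun r => PowerSeries.coeff r F i j) = _
    rw [PowerSeries.coeff_mk, PowerSeries.coeff_mk, Matrix.of_apply]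
  have h0 : PowerSeries.constantCoeff F = ((1 : (Matrix ι ι R)ˣ) : Matrix ι ι R) := by
    ext i j
    rw [← PowerSeries.coeff_zero_eq_constantCoeff_apply, PowerSeries.coeff_mk, Matrix.of_apply,
      PowerSeries.coeff_zero_eq_constantCoeff_apply, hT, Units.val_one, Matrix.one_apply]
  refine ⟨matrixOfSeries (PowerSeries.invOfUnit F 1), ?_, ?_⟩
  · rw [← hF, ← map_mul, PowerSeries.mul_invOfUnit _ _ h0, map_one]
  · rw [← hF, ← map_mul, PowerSeries.invOfUnit_mul _ _ h0, map_one]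

end MatrixInverse

/-! ### Relations between the Gauss factors -/

section GaussRelations

variable {N : ℕ} {R : Type*} [Ring R] {T : Fin N → Fin N → R⟦X⟧}

/-- The `k`-th Schur complement on its proper index set. -/
def schurBlock (T : Fin N → Fin N → R⟦X⟧) (k : ℕ) :
    Matrix {i : Fin N // k ≤ i} {i : Fin N // k ≤ i} R⟦X⟧ :=
  fun i j => schur T k i j

/-- Block inversion: the lower right corner of `T⁻¹` is inverse to the Schur complement. The
induction eliminates one row and column at a time, using the vanishing entries of the products in
row and column `k`. -/
theorem schurBlock_inverse
    (hT : ∀ i j, PowerSeries.constantCoeff (T i j) = if i = j then 1 else 0)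
    {T' : Matrix (Fin N) (Fin N) R⟦X⟧} (h1 : (Matrix.of T) * T' = 1) (h2 : T' * (Matrix.of T) = 1)
    (k : ℕ) (hk : k ≤ N) :
    schurBlock T k * T'.submatrix (↑) (↑) = 1 ∧ T'.submatrix (↑) (↑) * schurBlock T k = 1 := by
  suffices H : ∀ i l : Fin N, k ≤ i → k ≤ l →
      (∑ j : Fin N with k ≤ j.val, schur T k i j * T' j l = if i = l then 1 else 0) ∧
      (∑ j : Fin N with k ≤ j.val, T' i j * schur T k j l = if i = l then 1 else 0) by
    constructor <;> ext1 ⟨i, hi⟩ ⟨l, hl⟩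
    · rw [Matrix.mul_apply, Matrix.one_apply]
      simp only [schurBlock, Matrix.submatrix_apply, Subtype.mk.injEq]
      rw [← (H i l hi hl).1]
      exact (Finset.sum_subtype _ (by simp) (fun j => schur T k i j * T' j l)).symm
    · rw [Matrix.mul_apply, Matrix.one_apply]
      simp only [schurBlock, Matrix.submatrix_apply, Subtype.mk.injEq]
      rw [← (H i l hi hl).2]
      exact (Finset.sum_subtype _ (by simp) (fun j => T' i j * schur T k j l)).symm
  induction k with
  | zero =>
    intro i l _ _
    have e1 := congrFun (congrFun h1 i) l
    have e2 := congrFun (congrFun h2 i) l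
    rw [Matrix.mul_apply, Matrix.one_apply] at e1 e2
    simpa [schur] using And.intro e1 e2
  | succ k ih =>
    intro i l hi hl
    have h : k < N := hk
    set o : Fin N := ⟨k, h⟩
    have hio : i ≠ o := by rintro rfl; simp [o] at hi
    have hlo : o ≠ l := by rintro rfl; simp [o] at hl
    have hset : (Finset.univ.filter fun j : Fin N => k ≤ (j : ℕ)) =
        insert o (Finset.univ.filter fun j : Fin N => k + 1 ≤ (j : ℕ)) := by
      ext j
      simp [Fin.ext_iff, o]
      omega
    have hno : o ∉ Finset.univ.filter fun j : Fin N => k + 1 ≤ (j : ℕ) := by simp [o]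
    have ih' := fun i l => ih h.le (i := i) (l := l)
    simp only [hset, Finset.sum_insert hno] at ih'
    set g := PowerSeries.invOfUnit (schur T k o o) 1
    have g1 : schur T k o o * g = 1 := schur_diag_mul T hT o
    have g2 : g * schur T k o o = 1 := schur_diag_mul' T hT o
    have hs (i j) : schur T (k + 1) i j = schur T k i j - schur T k i o * g * schur T k o j := by
      simp [schur, h, o, g]
    have a1 := (ih' i l (by omega) (by omega)).1
    have a2 := (ih' o l le_rfl (by omega)).1
    have b1 := (ih' i l (by omega) (by omega)).2
    have b2 := (ih' i o (by omega) le_rfl).2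
    rw [if_neg hlo] at a2
    rw [if_neg hio] at b2
    constructor
    · simp only [hs, sub_mul, Finset.sum_sub_distrib, mul_assoc, ← Finset.mul_sum]
      rw [eq_neg_of_add_eq_zero_right a2, ← a1, mul_neg, ← mul_assoc g, g2]
      noncomm_ring
    · simp only [hs, mul_sub, Finset.sum_sub_distrib, ← mul_assoc, ← Finset.sum_mul]
      rw [eq_neg_of_add_eq_zero_right b2, ← b1, neg_mul, mul_assoc _ _ g, g1]
      noncomm_ring

variable {p : Fin N → ℕ}

/-- Invert `T`, restrict to a corner, invert again: the constant changes sign twice. -/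
theorem rtt_schurBlock (hT : ∀ i j, PowerSeries.constantCoeff (T i j) = if i = j then 1 else 0)
    (h : RTT p 1 (Matrix.of T)) (k : ℕ) (hk : k ≤ N) :
    RTT (fun i : {i : Fin N // k ≤ i} => p i) 1 (schurBlock T k) := by
  obtain ⟨T', h1, h2⟩ := exists_matrix_inverse (Matrix.of T) hT
  obtain ⟨e1, e2⟩ := schurBlock_inverse hT h1 h2 k hk
  have := ((h.inverse h1 h2).submatrix (fun i : {i : Fin N // k ≤ i} => (i : Fin N))).inverse e2 e1
  rwa [neg_neg] at this

/-- Schur complements of different sizes supercommute outside of common rows and columns. -/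
theorem schur_twisted_commute
    (hT : ∀ i j, PowerSeries.constantCoeff (T i j) = if i = j then 1 else 0)
    (h : RTT p 1 (Matrix.of T)) {k k' : ℕ} (hk : k' ≤ N) {i j q l : Fin N} (hi : k ≤ i)
    (hj : k ≤ j) (hi' : i < k') (hj' : j < k') (hq : k' ≤ q) (hl : k' ≤ l) :
    (-1 : ℤ) ^ ((p i + p j) * p q) • (inU (schur T k i j) * inV (schur T k' q l)) =
      (-1 : ℤ) ^ ((p i + p j) * p l) • (inV (schur T k' q l) * inU (schur T k i j)) := by
  obtain ⟨T', h1, h2⟩ := exists_matrix_inverse (Matrix.of T) hT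
  obtain ⟨e1, e2⟩ := schurBlock_inverse hT h1 h2 k (by omega)
  obtain ⟨e1', e2'⟩ := schurBlock_inverse hT h1 h2 k' hk
  -- The corner of `T⁻¹(v)` with indices at least `k'` belongs to the inverse of the `k`-th Schur
  -- complement and shares no index with `i`, `j`. The inverse of that corner is the `k'`-th Schur
  -- complement.
  have hm (a b : {i : Fin N // k' ≤ i}) := (rtt_schurBlock hT h k (by omega)).mixed e1 e2
    (i := ⟨i, hi⟩) (j := ⟨j, hj⟩) (k := ⟨a, by omega⟩) (l := ⟨b, by omega⟩)
    (by have := a.2; simp only [ne_eq, Subtype.mk.injEq, Fin.ext_iff]; omega)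
    (by have := b.2; simp only [ne_eq, Subtype.mk.injEq, Fin.ext_iff]; omega)
  exact twisted_commute_inverse (M := inV.mapMatrix (T'.submatrix (↑) (↑)))
    (M' := inV.mapMatrix (schurBlock T k')) (by rw [← map_mul, e2', map_one])
    (by rw [← map_mul, e1', map_one]) (fun a => (-1 : ℤ) ^ ((p i + p j) * p a))
    (inU (schur T k i j)) hm ⟨q, hq⟩ ⟨l, hl⟩

theorem zsmul_sign_cancel {M : Type*} [AddCommGroup M] {n : ℕ} {x y : M}
    (h : (-1 : ℤ) ^ n • x = (-1 : ℤ) ^ n • y) : x = y := by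
  rcases neg_one_pow_eq_or ℤ n with hn | hn <;> simpa [hn] using h

theorem coeffCommute_gaussD_schur
    (hT : ∀ i j, PowerSeries.constantCoeff (T i j) = if i = j then 1 else 0)
    (h : RTT p 1 (Matrix.of T)) {o q l : Fin N} {k : ℕ} (hk : k ≤ N) (ho : o < k) (hq : k ≤ q)
    (hl : k ≤ l) : CoeffCommute (gaussD T o) (schur T k q l) := by
  rw [coeffCommute_iff]
  have := schur_twisted_commute hT h hk (i := o) (j := o) le_rfl le_rfl ho ho hq hl
  rw [Even.neg_one_pow (by simp [parity_simps]), Even.neg_one_pow (by simp [parity_simps]),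
    one_smul, one_smul] at this
  exact this

theorem coeffCommute_schur_gaussD
    (hT : ∀ i j, PowerSeries.constantCoeff (T i j) = if i = j then 1 else 0)
    (h : RTT p 1 (Matrix.of T)) {i j o : Fin N} {k : ℕ} (hi : k ≤ i) (hj : k ≤ j) (hi' : i < o)
    (hj' : j < o) : CoeffCommute (gaussD T o) (schur T k i j) :=
  (coeffCommute_iff.2 (zsmul_sign_cancel
    (schur_twisted_commute hT h o.2.le hi hj hi' hj' le_rfl le_rfl))).symm

theorem coeffCommute_gaussD
    (hT : ∀ i j, PowerSeries.constantCoeff (T i j) = if i = j then 1 else 0)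
    (h : RTT p 1 (Matrix.of T)) (i j : Fin N) : CoeffCommute (gaussD T i) (gaussD T j) := by
  rcases lt_trichotomy i j with hij | rfl | hij
  · exact coeffCommute_gaussD_schur hT h j.2.le hij le_rfl le_rfl
  · exact (rtt_schurBlock hT h i i.2.le).coeffCommute_diag ⟨i, le_rfl⟩
  · exact (coeffCommute_gaussD_schur hT h i.2.le hij le_rfl le_rfl).symm

/-- `d_j` commutes with `e_{k,l}` and `f_{l,k}` unless `k ≤ j ≤ l`. -/
theorem coeffCommute_gaussD_gaussE_gaussF
    (hT : ∀ i j, PowerSeries.constantCoeff (T i j) = if i = j then 1 else 0)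
    (h : RTT p 1 (Matrix.of T)) {j k l : Fin N} (hkl : k < l) (hj : j < k ∨ l < j) :
    CoeffCommute (gaussD T j) (gaussE T k l) ∧ CoeffCommute (gaussD T j) (gaussF T l k) := by
  have hs (a b : Fin N) (ha : k ≤ a) (hb : k ≤ b) (ha' : a ≤ l) (hb' : b ≤ l) :
      CoeffCommute (gaussD T j) (schur T k a b) := by
    rcases hj with hj | hj
    · exact coeffCommute_gaussD_schur hT h k.2.le hj ha hb
    · exact coeffCommute_schur_gaussD hT h ha hb (ha'.trans_lt hj) (hb'.trans_lt hj)
  have hi := (hs k k le_rfl le_rfl hkl.le hkl.le).inverse_right (schur_diag_mul T hT k)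
    (schur_diag_mul' T hT k)
  exact ⟨hi.mul_right (hs k l le_rfl hkl.le hkl.le le_rfl),
    (hs l k hkl.le le_rfl le_rfl hkl.le).mul_right hi⟩

theorem raisingRel_gaussD_gaussE
    (hT : ∀ i j, PowerSeries.constantCoeff (T i j) = if i = j then 1 else 0)
    (h : RTT p 1 (Matrix.of T)) {k l : Fin N} (hkl : k < l) :
    RaisingRel ((-1) ^ p k) (gaussD T k) (gaussE T k l) := by
  have := (rtt_schurBlock hT h k k.2.le).raisingRel (o := ⟨k, le_rfl⟩) (j := ⟨l, hkl.le⟩)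
    (e := gaussE T k l) (schur_diag_mul' T hT k)
    (by simp only [schurBlock, gaussE]; rw [← mul_assoc, schur_diag_mul T hT, one_mul])
  rwa [one_mul] at this

theorem loweringRel_gaussD_gaussF
    (hT : ∀ i j, PowerSeries.constantCoeff (T i j) = if i = j then 1 else 0)
    (h : RTT p 1 (Matrix.of T)) {k l : Fin N} (hkl : k < l) :
    LoweringRel (-(-1) ^ p k) (gaussD T k) (gaussF T l k) := by
  have := (rtt_schurBlock hT h k k.2.le).loweringRel (o := ⟨k, le_rfl⟩) (j := ⟨l, hkl.le⟩)
    (f := gaussF T l k) (schur_diag_mul T hT k)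
    (by simp only [schurBlock, gaussF]; rw [mul_assoc, schur_diag_mul' T hT, mul_one])
  rwa [one_mul] at this

/-- The relations between `d_{k+1}` and `e_{k,k+1}`, `f_{k+1,k}`. -/
theorem gaussD_succ_rel
    (hT : ∀ i j, PowerSeries.constantCoeff (T i j) = if i = j then 1 else 0)
    (h : RTT p 1 (Matrix.of T)) {k l : Fin N} (hkl : (l : ℕ) = k + 1) :
    RaisingRel (-(-1) ^ p l) (gaussD T l) (gaussE T k l) ∧
      LoweringRel ((-1) ^ p l) (gaussD T l) (gaussF T l k) := by
  let g : Fin 2 → {i : Fin N // k ≤ i} := ![⟨k, le_rfl⟩, ⟨l, by rw [Fin.le_def]; omega⟩]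
  set B := (schurBlock T k).submatrix g g with hB
  have hneq : k ≠ l := by rintro rfl; omega
  have hRTT : RTT ((fun i : {i : Fin N // k ≤ i} => p i) ∘ g) 1 B :=
    (rtt_schurBlock hT h k k.2.le).submatrix g
  have hgi : Function.Injective g := by
    intro a b hab
    fin_cases a <;> fin_cases b <;> simp_all [g, Subtype.ext_iff]
  obtain ⟨B', h1, h2⟩ := exists_matrix_inverse B (by
    intro i j
    simp only [hB, Matrix.submatrix_apply, schurBlock]
    rw [constantCoeff_schur T hT k _ _ (g i).2 (g j).2]
    simp only [Subtype.coe_inj, hgi.eq_iff])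
  have hRTT' := hRTT.inverse h1 h2
  set q := PowerSeries.invOfUnit (schur T k k k) 1 with hq
  have b00 : B 0 0 = schur T k k k := rfl
  have b01 : B 0 1 = schur T k k l := rfl
  have b10 : B 1 0 = schur T k l k := rfl
  have b11 : B 1 1 = schur T k l l := rfl
  have q1 : B 0 0 * q = 1 := schur_diag_mul T hT k
  have q2 : q * B 0 0 = 1 := schur_diag_mul' T hT k
  have hE : gaussE T k l = q * B 0 1 := rfl
  have hF : gaussF T l k = B 1 0 * q := rfl
  have hD : gaussD T l = B 1 1 - B 1 0 * q * B 0 1 := by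
    have hk : (⟨(k : ℕ), k.2⟩ : Fin N) = k := rfl
    simp only [gaussD, hkl, schur, k.2, dif_pos, hk]
    rw [b10, b01, b11]
  have m01 := congrFun (congrFun h1 0) 1
  have m11 := congrFun (congrFun h1 1) 1
  have n10 := congrFun (congrFun h2 1) 0
  have n11 := congrFun (congrFun h2 1) 1
  simp only [Matrix.mul_apply, Fin.sum_univ_two, Matrix.one_apply] at m01 m11 n10 n11
  norm_num at m01 m11 n10 n11
  -- In the inverse of the `2 × 2` block the corner entry is `d_l⁻¹`, and the entries beside it are
  -- `-e d_l⁻¹` and `d_l⁻¹ (-f)`. Thus `-e` plays the role of a lowering series and `-f` that of a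
  -- raising series for `d_l⁻¹`.
  have e01 : B' 0 1 = -(gaussE T k l) * B' 1 1 := by
    have := congrArg (q * ·) m01
    simp only [mul_add, ← mul_assoc, q2, one_mul, mul_zero] at this
    rw [eq_neg_of_add_eq_zero_left this, hE, neg_mul]
  have e10 : B' 1 0 = B' 1 1 * -(gaussF T l k) := by
    have := congrArg (· * q) n10
    simp only [add_mul, mul_assoc, q1, mul_one, zero_mul] at this
    rw [eq_neg_of_add_eq_zero_left this, hF, mul_neg]
  have d1 : gaussD T l * B' 1 1 = 1 := by
    rw [← m11, e01, hD, hE]; noncomm_ring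
  have d2 : B' 1 1 * gaussD T l = 1 := by
    rw [← n11, e10, hD, hF]; noncomm_ring
  have r1 := (hRTT'.loweringRel d2 e01).neg.of_inverse d1 d2
  have r2 := (hRTT'.raisingRel d1 e10).neg.of_inverse d1 d2
  have hp : ((fun i : {i : Fin N // k ≤ i} => p i) ∘ g) 1 = p l := rfl
  rw [hp] at r1 r2
  exact ⟨by simpa using r1, by simpa using r2⟩

end GaussRelations

/-! ### Relations in the super Yangian -/

section Yangian

variable (m n : ℕ)

theorem freeComm_zero_left (i j k l : Fin (m + n)) (s : ℕ) : freeComm m n i j k l 0 s = 0 := by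
  by_cases h : i = j
  · subst h
    rw [freeComm, Even.neg_one_pow (by simp [parity_simps])]
    simp [freeT]
  · simp [freeComm, freeT, h]

theorem freeComm_zero_right (i j k l : Fin (m + n)) (s : ℕ) : freeComm m n i j k l s 0 = 0 := by
  by_cases h : k = l
  · subst h
    rw [freeComm, Even.neg_one_pow (by simp [parity_simps])]
    simp [freeT]
  · simp [freeComm, freeT, h]

theorem rtt_tSeries : RTT (par m n) 1 (Matrix.of (tSeries m n)) := by
  intro i j k l
  set φ := RingQuot.mkAlgHom ℂ (Rel m n)
  have hc (r s : ℕ) : coeffTwo r s (inU (tSeries m n i j) * inV (tSeries m n k l) -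
      (-1 : ℤ) ^ ((par m n i + par m n j) * (par m n k + par m n l)) •
        (inV (tSeries m n k l) * inU (tSeries m n i j))) = φ (freeComm m n i j k l r s) := by
    rw [coeffTwo_sub, coeffTwo_zsmul, coeffTwo_inU_mul_inV, coeffTwo_inV_mul_inU]
    simp [tSeries, freeComm, φ]
  simp only [RingHom.mapMatrix_apply, Matrix.map_apply, Matrix.of_apply, one_smul]
  refine coeffTwo_ext fun r s => ?_
  -- The defining relations are the coefficients with both exponents positive; in the other cases
  -- both sides vanish.
  rcases r with _ | r <;> rcases s with _ | s
  · rw [coeffTwo_diffUV_mul_zero_zero, coeffTwo_prodUV_mul_zero_left]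
  · rw [coeffTwo_diffUV_mul_zero_succ, coeffTwo_prodUV_mul_zero_left, hc, freeComm_zero_left,
      map_zero]
  · rw [coeffTwo_diffUV_mul_succ_zero, coeffTwo_prodUV_mul_zero_right, hc, freeComm_zero_right,
      map_zero, neg_zero]
  · rw [coeffTwo_diffUV_mul_succ, coeffTwo_prodUV_mul_succ, hc, hc, ← map_sub]
    refine (RingQuot.mkAlgHom_rel ℂ (Rel.rtt i j k l r s)).trans ?_
    rw [coeffTwo_zsmul, coeffTwo_sub, coeffTwo_inU_mul_inV, coeffTwo_inV_mul_inU]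
    simp [tSeries]

theorem commute_d (i j : Fin (m + n)) (r s : ℕ) : Commute (d m n i r) (d m n j s) :=
  coeffCommute_gaussD (constantCoeff_tSeries m n) (rtt_tSeries m n) i j r s

theorem d_zero (i : Fin (m + n)) : d m n i 0 = 1 := by
  rw [d, PowerSeries.coeff_zero_eq_constantCoeff_apply, gaussD,
    constantCoeff_schur _ (constantCoeff_tSeries m n) i i i le_rfl le_rfl, if_pos rfl]

theorem x_zero (σ : ℤˣ) (i : ℕ) (hi : i + 1 < m + n) : x m n σ i hi 0 = 0 := by
  rw [x, PowerSeries.coeff_zero_eq_constantCoeff_apply]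
  split_ifs
  · rw [gaussE, map_mul, constantCoeff_schur _ (constantCoeff_tSeries m n) _ _ _ le_rfl (by simp)]
    simp
  · rw [gaussF, map_mul, constantCoeff_schur _ (constantCoeff_tSeries m n) _ _ _ (by simp) le_rfl]
    simp

theorem form_simpleRoot_eps (i : ℕ) (hi : i + 1 < m + n) (j : Fin (m + n)) :
    form m n (simpleRoot m n i hi) (eps m n j) =
      if (j : ℕ) = i then (-1) ^ par m n j else if (j : ℕ) = i + 1 then -(-1) ^ par m n j else 0 := by
  rw [form, Finset.sum_eq_single j (by intro b _ hb; simp [eps, hb]) (by simp)]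
  by_cases h1 : (j : ℕ) = i
  · simp [eps, simpleRoot, Pi.single_apply, Fin.ext_iff, h1]
  · by_cases h2 : (j : ℕ) = i + 1 <;> simp [eps, simpleRoot, Pi.single_apply, Fin.ext_iff, h1, h2]

/-- The integer `(α_i, ε_j)`. -/
theorem exists_int_form (i : ℕ) (hi : i + 1 < m + n) (j : Fin (m + n)) :
    ∃ c : ℤ, (c : ℂ) = form m n (simpleRoot m n i hi) (eps m n j) ∧
      RaisingRel c (gaussD (tSeries m n) j)
        (gaussE (tSeries m n) ⟨i, i.lt_succ_self.trans hi⟩ ⟨i + 1, hi⟩) ∧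
      LoweringRel (-c) (gaussD (tSeries m n) j)
        (gaussF (tSeries m n) ⟨i + 1, hi⟩ ⟨i, i.lt_succ_self.trans hi⟩) := by
  have hT := constantCoeff_tSeries m n
  have hR := rtt_tSeries m n
  have hlt : (⟨i, i.lt_succ_self.trans hi⟩ : Fin (m + n)) < ⟨i + 1, hi⟩ := by simp [Fin.lt_def]
  rw [form_simpleRoot_eps]
  by_cases h1 : (j : ℕ) = i
  · obtain rfl : j = ⟨i, i.lt_succ_self.trans hi⟩ := Fin.ext h1
    exact ⟨(-1) ^ par m n _, by simp, raisingRel_gaussD_gaussE hT hR hlt,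
      loweringRel_gaussD_gaussF hT hR hlt⟩
  · by_cases h2 : (j : ℕ) = i + 1
    · obtain rfl : j = ⟨i + 1, hi⟩ := Fin.ext h2
      obtain ⟨e, f⟩ := gaussD_succ_rel hT hR (k := ⟨i, i.lt_succ_self.trans hi⟩)
        (l := ⟨i + 1, hi⟩) rfl
      exact ⟨-(-1) ^ par m n _, by simp, e, by rwa [neg_neg]⟩
    · obtain ⟨e, f⟩ := coeffCommute_gaussD_gaussE_gaussF hT hR hlt (j := j)
        (by simp only [Fin.lt_def]; omega)
      exact ⟨0, by simp [h1, h2], e.raisingRel, by rw [neg_zero]; exact f.loweringRel⟩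

theorem x_one_rel (i : ℕ) (hi : i + 1 < m + n) (j : Fin (m + n)) (r s : ℕ) :
    d m n j (r + 1) * x m n 1 i hi (s + 1) - x m n 1 i hi (s + 1) * d m n j (r + 1) -
      (d m n j r * x m n 1 i hi (s + 2) - x m n 1 i hi (s + 2) * d m n j r) =
    form m n (simpleRoot m n i hi) (eps m n j) • (d m n j r * x m n 1 i hi (s + 1)) := by
  obtain ⟨c, hc, hr, -⟩ := exists_int_form m n i hi j
  rw [← hc, Algebra.smul_def, map_intCast, ← zsmul_eq_mul]
  simpa only [d, x, if_true] using hr.coeff r s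

theorem x_neg_one_rel (i : ℕ) (hi : i + 1 < m + n) (j : Fin (m + n)) (r s : ℕ) :
    d m n j (r + 1) * x m n (-1) i hi (s + 1) - x m n (-1) i hi (s + 1) * d m n j (r + 1) -
      (d m n j r * x m n (-1) i hi (s + 2) - x m n (-1) i hi (s + 2) * d m n j r) =
    -form m n (simpleRoot m n i hi) (eps m n j) • (x m n (-1) i hi (s + 1) * d m n j r) := by
  obtain ⟨c, hc, -, hr⟩ := exists_int_form m n i hi j
  rw [← hc, ← Int.cast_neg, Algebra.smul_def, map_intCast, ← zsmul_eq_mul]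
  simpa only [d, x, if_neg (show (-1 : ℤˣ) ≠ 1 by decide)] using hr.coeff r s

end Yangian

/-! ### Derivatives of a simple pole -/

section Poles

theorem coeff_dz_zero (f : ℂ⟦X⟧) : PowerSeries.coeff 0 (dz f) = 0 := by
  simp [dz]

theorem coeff_dz_succ (f : ℂ⟦X⟧) (r : ℕ) :
    PowerSeries.coeff (r + 1) (dz f) = -(r : ℂ) * PowerSeries.coeff r f := by
  rcases r with _ | r
  · simp [dz, PowerSeries.coeff_X_pow_mul']
  · simp [dz, PowerSeries.coeff_X_pow_mul', PowerSeries.coeff_derivative]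
    ring

theorem coeff_pole_succ (a : ℂ) (s : ℕ) : PowerSeries.coeff (s + 1) (pole a) = a ^ s := by
  have h : (1 - PowerSeries.C a * PowerSeries.X)⁻¹ = PowerSeries.mk fun s => a ^ s := by
    rw [PowerSeries.inv_eq_iff_mul_eq_one (by simp)]
    ext s
    rcases s with _ | s
    · simp
    · simp [mul_sub, ← mul_assoc, PowerSeries.coeff_succ_mul_X, PowerSeries.coeff_one,
        PowerSeries.coeff_mul_C, pow_succ]
  rw [pole, PowerSeries.coeff_succ_X_mul, h, PowerSeries.coeff_mk]

theorem coeff_dz_pow_pole_zero (a : ℂ) (q : ℕ) :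
    PowerSeries.coeff 0 ((dz ^ q) (pole a)) = 0 := by
  rcases q with _ | q
  · simp [pole]
  · rw [pow_succ', Module.End.mul_apply, coeff_dz_zero]

theorem coeff_dz_pow_pole_succ (a : ℂ) (q s : ℕ) :
    PowerSeries.coeff (s + 1) ((dz ^ q) (pole a)) =
      (-1) ^ q * (s.descFactorial q : ℂ) * a ^ (s - q) := by
  induction q generalizing s with
  | zero => simp [coeff_pole_succ]
  | succ q ih =>
    rw [pow_succ' dz, Module.End.mul_apply, coeff_dz_succ]
    rcases s with _ | s
    · simp
    · rw [ih, Nat.succ_descFactorial_succ, Nat.add_sub_add_right]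
      push_cast
      ring

/-- `∑_q t_q (-∂)^q / q!` applied to `1/(z - a)`. -/
def poleCombination (D : ℕ) (t : ℕ → ℂ) : Polynomial ℂ :=
  ∑ q ∈ Finset.range (D + 1), Polynomial.C ((-1) ^ q / (q.factorial : ℂ) * t q) * Polynomial.X ^ q

theorem natDegree_poleCombination_le (D : ℕ) (t : ℕ → ℂ) :
    (poleCombination D t).natDegree ≤ D := by
  refine Polynomial.natDegree_sum_le_of_forall_le _ _ fun q hq => ?_
  exact (Polynomial.natDegree_C_mul_X_pow_le _ _).trans (Finset.mem_range_succ_iff.1 hq)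

theorem coeff_poleCombination_zero (D : ℕ) (t : ℕ → ℂ) (a : ℂ) :
    PowerSeries.coeff 0 (Polynomial.aeval dz (poleCombination D t) (pole a)) = 0 := by
  simp [poleCombination, map_sum, LinearMap.sum_apply, -PowerSeries.coeff_zero_eq_constantCoeff,
    coeff_dz_pow_pole_zero, Module.algebraMap_end_apply]

/-- Since `(-∂)^q/q!` sends `1/(z - a)` to `(z - a)^{-q-1}`, the coefficients are those of the
binomial expansion of `(a + T)^s`, with `t q` standing for an entry of `T^q X_0`. Terms with `q > D`
or `q > s` are zero, so either bound may be used for the sum. -/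
theorem coeff_poleCombination_succ (D : ℕ) (t : ℕ → ℂ) (a : ℂ) (s : ℕ) (ht : ∀ q, D < q → t q = 0) :
    PowerSeries.coeff (s + 1) (Polynomial.aeval dz (poleCombination D t) (pole a)) =
      ∑ q ∈ Finset.range (s + 1), (s.choose q : ℂ) * a ^ (s - q) * t q := by
  have h1 : PowerSeries.coeff (s + 1) (Polynomial.aeval dz (poleCombination D t) (pole a)) =
      ∑ q ∈ Finset.range (D + 1), (s.choose q : ℂ) * a ^ (s - q) * t q := by
    simp only [poleCombination, map_sum, map_mul, map_pow, Polynomial.aeval_C, Polynomial.aeval_X,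
      LinearMap.sum_apply, Module.End.mul_apply, Module.algebraMap_end_apply]
    refine Finset.sum_congr rfl fun q _ => ?_
    rw [PowerSeries.coeff_smul, PowerSeries.coeff_smul, coeff_dz_pow_pole_succ, Nat.descFactorial_eq_factorial_mul_choose]
    have : (q.factorial : ℂ) ≠ 0 := by exact_mod_cast q.factorial_ne_zero
    have h2 : ((-1 : ℂ) ^ q) * (-1) ^ q = 1 := by rw [← pow_add, Even.neg_one_pow ⟨_, rfl⟩]
    push_cast
    rw [smul_eq_mul, smul_eq_mul]
    field_simp
    linear_combination (t q * (s.choose q : ℂ) * a ^ (s - q)) * h2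
  rw [h1, Finset.sum_subset (Finset.range_subset_range.2 (Nat.le_add_right (D + 1) (s + 1))),
    Finset.sum_subset (Finset.range_subset_range.2 (Nat.le_add_left (s + 1) (D + 1)))]
  · intro q _ hq
    rw [Nat.choose_eq_zero_of_lt (by simpa using hq)]; simp
  · intro q _ hq
    rw [ht q (by simpa using hq), mul_zero]

end Poles

/-! ### Triangular bases -/

section Triangular

/-- A nilpotent map on a nonzero space is not surjective, so its range lies in a hyperplane. That
hyperplane is invariant; its basis is completed by any vector outside it, whose image lies in the
hyperplane again. -/
theorem exists_basis_upper_aux (n : ℕ) : ∀ {W : Type*} [AddCommGroup W] [Module ℂ W]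
    [FiniteDimensional ℂ W] (f : Module.End ℂ W), IsNilpotent f → Module.finrank ℂ W = n →
    ∃ b : Module.Basis (Fin n) ℂ W, ∀ k, f (b k) ∈ Submodule.span ℂ (b '' Set.Iio k) := by
  induction n with
  | zero =>
    intro W _ _ _ f _ h
    exact ⟨Module.finBasisOfFinrankEq ℂ W h, fun k => k.elim0⟩
  | succ n ih =>
    intro W _ _ _ f hf h
    have : Nontrivial W := Module.nontrivial_of_finrank_pos (R := ℂ) (by omega)
    have hr : LinearMap.range f < ⊤ := by
      refine lt_top_iff_ne_top.2 fun htop => ?_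
      obtain ⟨k, hk⟩ := hf
      have hs : Function.Surjective (f ^ k) := by
        rw [Module.End.coe_pow]; exact (LinearMap.range_eq_top.1 htop).iterate k
      obtain ⟨w, hw⟩ := exists_ne (0 : W)
      obtain ⟨y, hy⟩ := hs w
      exact hw (by rw [← hy, hk]; rfl)
    obtain ⟨φ, hφ, hle⟩ := Submodule.exists_le_ker_of_lt_top _ hr
    have hfr : Module.finrank ℂ (LinearMap.ker φ) = n := by
      have := Module.Dual.finrank_ker_add_one_of_ne_zero hφ
      omega
    have hmap : ∀ w ∈ LinearMap.ker φ, f w ∈ LinearMap.ker φ := fun w _ => hle ⟨w, rfl⟩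
    have hnil : IsNilpotent (f.restrict hmap) := by
      obtain ⟨k, hk⟩ := hf
      refine ⟨k, LinearMap.ext fun w => Subtype.ext ?_⟩
      rw [Module.End.pow_restrict k hmap]
      simp [hk]
    obtain ⟨b, hb⟩ := ih (f.restrict hmap) hnil hfr
    obtain ⟨y, hy⟩ : ∃ y, φ y ≠ 0 := by
      by_contra! hcon
      exact hφ (LinearMap.ext hcon)
    let b' := Module.Basis.mkFinSnoc b y
      (by
        intro c x hx hc
        have := congrArg φ hc
        rw [map_add, LinearMap.mem_ker.1 hx, map_smul, add_zero, map_zero, smul_eq_mul] at this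
        exact (mul_eq_zero.1 this).resolve_right hy)
      (by
        intro z
        refine ⟨-(φ z / φ y), ?_⟩
        rw [LinearMap.mem_ker, map_add, map_smul, smul_eq_mul]
        field_simp
        ring)
    have hbc (i : Fin n) : b' i.castSucc = b i := by simp [b']
    have hbl : b' (Fin.last n) = y := by simp [b']
    have hspan (s : Set (Fin n)) : (Submodule.span ℂ (b '' s)).map (LinearMap.ker φ).subtype =
        Submodule.span ℂ (b' '' (Fin.castSucc '' s)) := by
      rw [Submodule.map_span, Set.image_image, Set.image_image]
      simp only [hbc]; rfl
    refine ⟨b', fun k => ?_⟩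
    induction k using Fin.lastCases with
    | last =>
      rw [hbl]
      have : (⟨f y, hle ⟨y, rfl⟩⟩ : LinearMap.ker φ) ∈ Submodule.span ℂ (b '' Set.univ) := by
        rw [Set.image_univ, b.span_eq]; trivial
      have := Submodule.mem_map_of_mem (f := (LinearMap.ker φ).subtype) this
      rw [hspan] at this
      refine Submodule.span_mono (Set.image_mono ?_) this
      rintro _ ⟨i, -, rfl⟩
      exact Fin.castSucc_lt_last i
    | cast i =>
      have := Submodule.mem_map_of_mem (f := (LinearMap.ker φ).subtype) (hb i)
      rw [hspan] at this
      rw [hbc]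
      refine Submodule.span_mono (Set.image_mono ?_) this
      rintro _ ⟨j, hj, rfl⟩
      exact hj

variable {W : Type*} [AddCommGroup W] [Module ℂ W] [FiniteDimensional ℂ W]

/-- A nilpotent endomorphism is strictly upper triangular in some basis. -/
theorem exists_basis_strictly_upper {f : Module.End ℂ W} (hf : IsNilpotent f) :
    ∃ b : Module.Basis (Fin (Module.finrank ℂ W)) ℂ W, ∀ k l, k ≤ l → b.repr (f (b k)) l = 0 := by
  obtain ⟨b, hb⟩ := exists_basis_upper_aux _ f hf rfl
  refine ⟨b, fun k l hkl => ?_⟩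
  have := b.mem_span_image.1 (hb k)
  by_contra hne
  exact absurd (this (Finsupp.mem_support_iff.2 hne)) (by simpa using hkl)

/-- A nilpotent endomorphism is strictly lower triangular in some basis. -/
theorem exists_basis_strictly_lower {f : Module.End ℂ W} (hf : IsNilpotent f) :
    ∃ b : Module.Basis (Fin (Module.finrank ℂ W)) ℂ W, ∀ k l, l ≤ k → b.repr (f (b k)) l = 0 := by
  obtain ⟨b, hb⟩ := exists_basis_strictly_upper hf
  refine ⟨b.reindex Fin.revPerm, fun k l hkl => ?_⟩
  simpa using hb k.rev l.rev (Fin.rev_le_rev.2 hkl)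

end Triangular

/-! ### Operators on a space of linear maps -/

section HomSpace

variable {W₁ W₂ : Type*} [AddCommGroup W₁] [Module ℂ W₁] [AddCommGroup W₂] [Module ℂ W₂]

/-- `Y ↦ B Y`. -/
def homLeft (W₁ : Type*) [AddCommGroup W₁] [Module ℂ W₁] (B : Module.End ℂ W₂) :
    Module.End ℂ (W₁ →ₗ[ℂ] W₂) := LinearMap.compRight ℂ B

/-- `Y ↦ Y A`. -/
def homRight (W₂ : Type*) [AddCommGroup W₂] [Module ℂ W₂] (A : Module.End ℂ W₁) :
    Module.End ℂ (W₁ →ₗ[ℂ] W₂) := LinearMap.lcomp ℂ W₂ A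

@[simp] theorem homLeft_apply (B : Module.End ℂ W₂) (Y : W₁ →ₗ[ℂ] W₂) (w : W₁) :
    homLeft W₁ B Y w = B (Y w) := rfl

@[simp] theorem homRight_apply (A : Module.End ℂ W₁) (Y : W₁ →ₗ[ℂ] W₂) (w : W₁) :
    homRight W₂ A Y w = Y (A w) := rfl

theorem homLeft_pow_apply (B : Module.End ℂ W₂) (k : ℕ) (Y : W₁ →ₗ[ℂ] W₂) (w : W₁) :
    (homLeft W₁ B ^ k) Y w = (B ^ k) (Y w) := by
  induction k generalizing w with
  | zero => rfl
  | succ k ih => rw [pow_succ', pow_succ', Module.End.mul_apply, Module.End.mul_apply,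
      homLeft_apply, ih]

theorem homRight_pow_apply (A : Module.End ℂ W₁) (k : ℕ) (Y : W₁ →ₗ[ℂ] W₂) (w : W₁) :
    (homRight W₂ A ^ k) Y w = Y ((A ^ k) w) := by
  induction k generalizing w with
  | zero => rfl
  | succ k ih => rw [pow_succ', pow_succ, Module.End.mul_apply, Module.End.mul_apply,
      homRight_apply, ih]

theorem homLeft_nilpotent {B : Module.End ℂ W₂} {b : ℂ} (h : IsNilpotent (B - b • 1)) :
    IsNilpotent (homLeft W₁ B - b • 1) := by
  obtain ⟨k, hk⟩ := h
  have e : homLeft W₁ B - b • 1 = homLeft W₁ (B - b • 1) := by ext; simp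
  refine ⟨k, LinearMap.ext fun Y => LinearMap.ext fun w => ?_⟩
  rw [e, homLeft_pow_apply, hk]; rfl

theorem homRight_nilpotent {A : Module.End ℂ W₁} {a : ℂ} (h : IsNilpotent (A - a • 1)) :
    IsNilpotent (homRight W₂ A - a • 1) := by
  obtain ⟨k, hk⟩ := h
  have e : homRight W₂ A - a • 1 = homRight W₂ (A - a • 1) := by ext; simp
  refine ⟨k, LinearMap.ext fun Y => LinearMap.ext fun w => ?_⟩
  rw [e, homRight_pow_apply, hk]; simp

/-- The operator `Y ↦ N Y - Y M` moves the components `(k, l)` of `Y` to larger `k + l`. -/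
theorem repr_homLeft_sub_homRight_pow {d₁ d₂ : ℕ} (v : Module.Basis (Fin d₁) ℂ W₁)
    (w : Module.Basis (Fin d₂) ℂ W₂) {N : Module.End ℂ W₂} {M : Module.End ℂ W₁}
    (hM : ∀ k k', k ≤ k' → v.repr (M (v k)) k' = 0)
    (hN : ∀ l l', l' ≤ l → w.repr (N (w l)) l' = 0) (Y : W₁ →ₗ[ℂ] W₂) (q : ℕ) :
    ∀ (k : Fin d₁) (l : Fin d₂), (k : ℕ) + l < q →
      w.repr (((homLeft W₁ N - homRight W₂ M) ^ q) Y (v k)) l = 0 := by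
  induction q with
  | zero => intro k l h; omega
  | succ q ih =>
    intro k l h
    rw [pow_succ', Module.End.mul_apply]
    set Z := ((homLeft W₁ N - homRight W₂ M) ^ q) Y
    rw [LinearMap.sub_apply, LinearMap.sub_apply, homLeft_apply, homRight_apply, map_sub,
      Finsupp.sub_apply]
    have e1 : w.repr (N (Z (v k))) l = 0 := by
      rw [← w.sum_repr (Z (v k))]
      simp only [map_sum, map_smul, Finsupp.coe_finsetSum, Finset.sum_apply, Finsupp.smul_apply]
      refine Finset.sum_eq_zero fun l' _ => ?_
      rcases le_or_gt l l' with hl | hl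
      · rw [hN l' l hl, smul_zero]
      · rw [ih k l' (by omega), zero_smul]
    have e2 : w.repr (Z (M (v k))) l = 0 := by
      rw [← v.sum_repr (M (v k))]
      simp only [map_sum, map_smul, Finsupp.coe_finsetSum, Finset.sum_apply, Finsupp.smul_apply]
      refine Finset.sum_eq_zero fun k' _ => ?_
      rcases le_or_gt k k' with hk | hk
      · rw [hM k k' hk, zero_smul]
      · rw [ih k' l (by omega), smul_zero]
    rw [e1, e2, sub_zero]

/-- A sequence with `X_{s+1} = (a + T) X_s`, `T Y = N Y - Y M` with nilpotent `N` and `M`, is given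
by derivatives of a pole at `a`. -/
theorem exists_bases_poles [FiniteDimensional ℂ W₁] [FiniteDimensional ℂ W₂]
    {N : Module.End ℂ W₂} {M : Module.End ℂ W₁} (hN : IsNilpotent N) (hM : IsNilpotent M) (a : ℂ)
    (X : ℕ → W₁ →ₗ[ℂ] W₂) (hX : ∀ s, X (s + 1) = a • X s + (N ∘ₗ X s - X s ∘ₗ M)) :
    ∃ (v : Module.Basis (Fin (Module.finrank ℂ W₁)) ℂ W₁)
      (w : Module.Basis (Fin (Module.finrank ℂ W₂)) ℂ W₂)
      (P : Fin (Module.finrank ℂ W₁) → Fin (Module.finrank ℂ W₂) → Polynomial ℂ),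
      (∀ k l, (P k l).natDegree ≤ (k : ℕ) + l) ∧
      (∀ k l, PowerSeries.coeff 0 (Polynomial.aeval dz (P k l) (pole a)) = 0) ∧
      ∀ k s, X s (v k) =
        ∑ l, PowerSeries.coeff (s + 1) (Polynomial.aeval dz (P k l) (pole a)) • w l := by
  obtain ⟨v, hv⟩ := exists_basis_strictly_upper hM
  obtain ⟨w, hw⟩ := exists_basis_strictly_lower hN
  set T := homLeft W₁ N - homRight W₂ M with hT
  refine ⟨v, w, fun k l => poleCombination (k + l) fun q => w.repr ((T ^ q) (X 0) (v k)) l,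
    fun k l => natDegree_poleCombination_le _ _, fun k l => coeff_poleCombination_zero _ _ _,
    fun k s => ?_⟩
  have hpow : X s = ((T + a • 1) ^ s) (X 0) := by
    induction s with
    | zero => rfl
    | succ s ih =>
      rw [pow_succ', Module.End.mul_apply, ← ih, hX, add_comm]
      rfl
  rw [← w.sum_repr (X s (v k))]
  refine Finset.sum_congr rfl fun l _ => ?_
  rw [coeff_poleCombination_succ _ _ _ _ fun q hq =>
    repr_homLeft_sub_homRight_pow v w hv hw (X 0) q k l hq]
  congr 1
  -- The scalar `a` commutes with `T`, so the binomial theorem applies.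
  rw [hpow, Commute.add_pow ((Commute.one_right T).smul_right a)]
  simp only [LinearMap.sum_apply, map_sum, Finsupp.coe_finsetSum, Finset.sum_apply, smul_pow,
    one_pow, mul_smul_comm, mul_one, LinearMap.smul_apply, ← nsmul_eq_mul']
  refine Finset.sum_congr rfl fun q _ => ?_
  simp
  ring

end HomSpace

/-! ### Operators with a single eigenvalue -/

section QuasiScalar

variable {E : Type*} [Ring E] [Algebra ℂ E]

/-- `f` is the sum of the scalar `a` and a nilpotent element. -/
def IsQuasiScalar (S : Subalgebra ℂ E) (f : E) (a : ℂ) : Prop :=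
  f ∈ S ∧ IsNilpotent (f - a • 1)

variable {S : Subalgebra ℂ E} {f g : E} {a b : ℂ}

theorem smul_one_mem (S : Subalgebra ℂ E) (a : ℂ) : a • (1 : E) ∈ S := S.smul_mem S.one_mem a

theorem IsQuasiScalar.sub (hS : ∀ f ∈ S, ∀ g ∈ S, Commute f g) (hf : IsQuasiScalar S f a)
    (hg : IsQuasiScalar S g b) : IsQuasiScalar S (f - g) (a - b) := by
  refine ⟨S.sub_mem hf.1 hg.1, ?_⟩
  have e : f - g - (a - b) • 1 = (f - a • 1) - (g - b • 1) := by rw [sub_smul]; abel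
  rw [e]
  exact (hS _ (S.sub_mem hf.1 (smul_one_mem S a)) _
    (S.sub_mem hg.1 (smul_one_mem S b))).isNilpotent_sub hf.2 hg.2

theorem IsQuasiScalar.smul (c : ℂ) (hf : IsQuasiScalar S f a) :
    IsQuasiScalar S (c • f) (c * a) := by
  refine ⟨S.smul_mem hf.1 c, ?_⟩
  rw [mul_smul, ← smul_sub]
  exact hf.2.smul c

theorem IsQuasiScalar.mul (hS : ∀ f ∈ S, ∀ g ∈ S, Commute f g) (hf : IsQuasiScalar S f a)
    (hg : IsQuasiScalar S g b) : IsQuasiScalar S (f * g) (a * b) := by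
  refine ⟨S.mul_mem hf.1 hg.1, ?_⟩
  have e : f * g - (a * b) • 1 = f * (g - b • 1) + b • (f - a • 1) := by
    rw [mul_sub, smul_sub, mul_smul_comm, mul_one, smul_smul, mul_comm b]; abel
  have m1 := S.sub_mem hf.1 (smul_one_mem S a)
  have m2 := S.sub_mem hg.1 (smul_one_mem S b)
  rw [e]
  exact (hS _ (S.mul_mem hf.1 m2) _ (S.smul_mem m1 b)).isNilpotent_add
    ((hS _ hf.1 _ m2).isNilpotent_mul_left hg.2) (hf.2.smul b)

theorem commute_of_mem_adjoin {s : Set E} (hs : ∀ f ∈ s, ∀ g ∈ s, Commute f g) :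
    ∀ f ∈ Algebra.adjoin ℂ s, ∀ g ∈ Algebra.adjoin ℂ s, Commute f g := fun _ hf _ hg =>
  Algebra.commute_of_mem_adjoin_of_forall_mem_commute hg fun y hy =>
    (Algebra.commute_of_mem_adjoin_of_forall_mem_commute hf fun x hx => hs y hy x hx).symm

/-- On a vector killed by `F`, the power `(F - e)^k` acts as `(-e)^k`. -/
theorem eq_zero_of_isNilpotent_sub {H : Type*} [AddCommGroup H] [Module ℂ H]
    {F : Module.End ℂ H} {e : ℂ} (hF : IsNilpotent (F - e • 1)) {x : H} (hx : x ≠ 0)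
    (h : F x = 0) : e = 0 := by
  obtain ⟨k, hk⟩ := hF
  have hp : ∀ k : ℕ, ((F - e • 1) ^ k) x = (-e) ^ k • x := by
    intro k
    induction k with
    | zero => simp
    | succ k ih =>
      rw [pow_succ', Module.End.mul_apply, ih, map_smul, LinearMap.sub_apply, h]
      simp [pow_succ, mul_smul]
  have := hp k
  rw [hk, LinearMap.zero_apply, eq_comm, smul_eq_zero] at this
  exact neg_eq_zero.1 (eq_zero_of_pow_eq_zero (this.resolve_right hx))

end QuasiScalar

/-! ### Matrix coefficients of a raising or lowering operator -/

section Recursion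

variable {J H : Type*} [AddCommGroup H] [Module ℂ H] {l r g : J → ℕ → Module.End ℂ H}
  {X : ℕ → H} {c : J → ℂ}

/-- The relation with `p = 0` gives `(l_1 - r_1) X_{s+1} = c X_{s+1}`, because `l_0 = r_0`; inserted
into the relation with `p = 1`, it can be solved for `X_{s+1}` as `c ≠ 0`. -/
theorem recursion_step (hl : ∀ j, l j 0 = 1) (hr : ∀ j, r j 0 = 1) (hg : ∀ j, g j 0 = 1)
    (hrel : ∀ j p s, (l j (p + 1) - r j (p + 1)) (X s) - (l j p - r j p) (X (s + 1)) =
      c j • g j p (X s)) {i : J} (hi : c i ≠ 0) (s : ℕ) :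
    X (s + 1) = ((c i)⁻¹ • (l i 2 - r i 2) - g i 1) (X s) := by
  have h0 := hrel i 0 (s + 1)
  have h1 := hrel i 1 s
  rw [hl, hr, hg, sub_self, LinearMap.zero_apply, sub_zero, Module.End.one_apply] at h0
  rw [h0] at h1
  rw [LinearMap.sub_apply, LinearMap.smul_apply, sub_eq_iff_eq_add.1 h1, smul_add, smul_smul,
    smul_smul, inv_mul_cancel₀ hi, one_smul, one_smul, add_sub_cancel_left]

/-- Replacing `X_{s+1}` by the recursion turns each relation into an operator annihilating `X_s ≠
0`. Eigenvalues of commuting quasi-scalars add and multiply, so the identity is the vanishing of the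
single eigenvalue of this operator. -/
theorem eigenvalue_relation {S : Subalgebra ℂ (Module.End ℂ H)}
    (hS : ∀ f ∈ S, ∀ g ∈ S, Commute f g) {ν μ γ : J → ℕ → ℂ}
    (hlν : ∀ j p, IsQuasiScalar S (l j p) (ν j p)) (hrμ : ∀ j p, IsQuasiScalar S (r j p) (μ j p))
    (hgγ : ∀ j p, IsQuasiScalar S (g j p) (γ j p))
    (hl : ∀ j, l j 0 = 1) (hr : ∀ j, r j 0 = 1) (hg : ∀ j, g j 0 = 1)
    (hrel : ∀ j p s, (l j (p + 1) - r j (p + 1)) (X s) - (l j p - r j p) (X (s + 1)) =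
      c j • g j p (X s)) {i : J} (hi : c i ≠ 0) {s : ℕ} (hs : X s ≠ 0) (j : J) (p : ℕ) :
    (ν j (p + 1) - μ j (p + 1)) - (ν j p - μ j p) * ((c i)⁻¹ * (ν i 2 - μ i 2) - γ i 1) =
      c j * γ j p := by
  have hL := (((hlν i 2).sub hS (hrμ i 2)).smul (c i)⁻¹).sub hS (hgγ i 1)
  have hF := ((((hlν j (p + 1)).sub hS (hrμ j (p + 1))).sub hS
    (((hlν j p).sub hS (hrμ j p)).mul hS hL)).sub hS ((hgγ j p).smul (c j))).2
  rw [← sub_eq_zero]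
  refine eq_zero_of_isNilpotent_sub hF hs ?_
  rw [LinearMap.sub_apply, LinearMap.sub_apply, Module.End.mul_apply,
    ← recursion_step hl hr hg hrel hi, hrel, LinearMap.smul_apply, sub_self]

end Recursion

/-! ### Blocks between two generalized weight spaces -/

section Blocks

variable {J W₁ W₂ : Type*} [AddCommGroup W₁] [Module ℂ W₁] [AddCommGroup W₂] [Module ℂ W₂]
  [FiniteDimensional ℂ W₁] [FiniteDimensional ℂ W₂]
  {A : J → ℕ → Module.End ℂ W₁} {B : J → ℕ → Module.End ℂ W₂} {μ ν : J → ℕ → ℂ}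
  {X : ℕ → W₁ →ₗ[ℂ] W₂} {c : J → ℂ}

/-- Matrix coefficients of operators with `[d_{p+1}, x_s] - [d_p, x_{s+1}] = c d_p x_s`
(if `raising` holds) or `c x_s d_p` (otherwise) between generalized eigenspaces. -/
theorem exists_pole (raising : Prop) [Decidable raising]
    (hA : ∀ j p k q, Commute (A j p) (A k q)) (hB : ∀ j p k q, Commute (B j p) (B k q))
    (hA0 : ∀ j, A j 0 = 1) (hB0 : ∀ j, B j 0 = 1)
    (hAμ : ∀ j p, IsNilpotent (A j p - μ j p • 1)) (hBν : ∀ j p, IsNilpotent (B j p - ν j p • 1))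
    (hrel : ∀ j p s, B j (p + 1) ∘ₗ X s - X s ∘ₗ A j (p + 1) -
      (B j p ∘ₗ X (s + 1) - X (s + 1) ∘ₗ A j p) =
        c j • if raising then B j p ∘ₗ X s else X s ∘ₗ A j p)
    {i : J} (hi : c i ≠ 0) (hX : ∃ s, X s ≠ 0) :
    ∃ a : ℂ, (∀ j p, (ν j (p + 1) - μ j (p + 1)) - (ν j p - μ j p) * a =
        c j * if raising then ν j p else μ j p) ∧
      ∃ (v : Module.Basis (Fin (Module.finrank ℂ W₁)) ℂ W₁)
      (w : Module.Basis (Fin (Module.finrank ℂ W₂)) ℂ W₂)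
      (P : Fin (Module.finrank ℂ W₁) → Fin (Module.finrank ℂ W₂) → Polynomial ℂ),
      (∀ k l, (P k l).natDegree ≤ (k : ℕ) + l) ∧
      (∀ k l, PowerSeries.coeff 0 (Polynomial.aeval dz (P k l) (pole a)) = 0) ∧
      ∀ k s, X s (v k) =
        ∑ l, PowerSeries.coeff (s + 1) (Polynomial.aeval dz (P k l) (pole a)) • w l := by
  let L : J → ℕ → Module.End ℂ (W₁ →ₗ[ℂ] W₂) := fun j p => homLeft W₁ (B j p)
  let R : J → ℕ → Module.End ℂ (W₁ →ₗ[ℂ] W₂) := fun j p => homRight W₂ (A j p)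
  let s : Set (Module.End ℂ (W₁ →ₗ[ℂ] W₂)) :=
    Set.range (fun q : J × ℕ => L q.1 q.2) ∪ Set.range fun q : J × ℕ => R q.1 q.2
  have hS : ∀ f ∈ Algebra.adjoin ℂ s, ∀ g ∈ Algebra.adjoin ℂ s, Commute f g := by
    refine commute_of_mem_adjoin ?_
    -- A left and a right multiplication commute by associativity; two of the same kind commute
    -- because the `B`, respectively the `A`, do.
    rintro _ (⟨q, rfl⟩ | ⟨q, rfl⟩) _ (⟨q', rfl⟩ | ⟨q', rfl⟩) <;> ext Y w
    · exact congrArg (fun F : Module.End ℂ W₂ => F (Y w)) (hB q.1 q.2 q'.1 q'.2).eq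
    · rfl
    · rfl
    · exact congrArg (fun F : Module.End ℂ W₁ => Y (F w)) (hA q.1 q.2 q'.1 q'.2).eq.symm
  have hL (j p) : IsQuasiScalar (Algebra.adjoin ℂ s) (L j p) (ν j p) :=
    ⟨Algebra.subset_adjoin (Or.inl ⟨(j, p), rfl⟩), homLeft_nilpotent (hBν j p)⟩
  have hR (j p) : IsQuasiScalar (Algebra.adjoin ℂ s) (R j p) (μ j p) :=
    ⟨Algebra.subset_adjoin (Or.inr ⟨(j, p), rfl⟩), homRight_nilpotent (hAμ j p)⟩
  have hL0 (j) : L j 0 = 1 := by ext Y w; simp [L, hB0]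
  have hR0 (j) : R j 0 = 1 := by ext Y w; simp [R, hA0]
  have hSA := commute_of_mem_adjoin (s := Set.range fun q : J × ℕ => A q.1 q.2) (by
    rintro _ ⟨q, rfl⟩ _ ⟨q', rfl⟩; exact hA _ _ _ _)
  have hSB := commute_of_mem_adjoin (s := Set.range fun q : J × ℕ => B q.1 q.2) (by
    rintro _ ⟨q, rfl⟩ _ ⟨q', rfl⟩; exact hB _ _ _ _)
  have qA (j p) : IsQuasiScalar (Algebra.adjoin ℂ (Set.range fun q : J × ℕ => A q.1 q.2))
      (A j p) (μ j p) := ⟨Algebra.subset_adjoin ⟨(j, p), rfl⟩, hAμ j p⟩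
  have qB (j p) : IsQuasiScalar (Algebra.adjoin ℂ (Set.range fun q : J × ℕ => B q.1 q.2))
      (B j p) (ν j p) := ⟨Algebra.subset_adjoin ⟨(j, p), rfl⟩, hBν j p⟩
  obtain ⟨t, ht⟩ := hX
  by_cases hra : raising
  · simp only [if_pos hra] at hrel ⊢
    have hrel' : ∀ j p s, (L j (p + 1) - R j (p + 1)) (X s) - (L j p - R j p) (X (s + 1)) =
      c j • L j p (X s) := hrel
    -- Here `X_{s+1} = (c⁻¹ B_2 - B_1) X_s - X_s (c⁻¹ A_2)`; `N` and `M` are the nilpotent parts of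
    -- the two brackets.
    refine ⟨_, eigenvalue_relation hS hL hR hL hL0 hR0 hL0 hrel' hi ht,
      exists_bases_poles (((qB i 2).smul (c i)⁻¹).sub hSB (qB i 1)).2 ((qA i 2).smul (c i)⁻¹).2
        _ X fun s => ?_⟩
    rw [recursion_step hL0 hR0 hL0 hrel' hi]
    ext w
    simp [L, R, smul_sub, sub_smul, mul_sub]
    module
  · simp only [if_neg hra] at hrel ⊢
    have hrel' : ∀ j p s, (L j (p + 1) - R j (p + 1)) (X s) - (L j p - R j p) (X (s + 1)) =
      c j • R j p (X s) := hrel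
    -- Now the term with `p = 1` acts on the right: `X_{s+1} = (c⁻¹ B_2) X_s - X_s (c⁻¹ A_2 + A_1)`.
    have qM := ((qA i 2).smul (c i)⁻¹).sub hSA ((qA i 1).smul (-1))
    refine ⟨_, eigenvalue_relation hS hL hR hR hL0 hR0 hR0 hrel' hi ht,
      exists_bases_poles ((qB i 2).smul (c i)⁻¹).2 qM.2 _ X fun s => ?_⟩
    rw [recursion_step hL0 hR0 hR0 hrel' hi]
    ext w
    simp [L, R, smul_sub, sub_smul, mul_sub]
    module

end Blocks

/-! ### ℓ-weights and generalized ℓ-weight spaces -/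

section EllWeights

variable {m n : ℕ}

theorem EllWeight.coeff_zero (ζ : EllWeight m n) (i : Fin (m + n)) : ζ.coeff i 0 = 1 := by
  have h := (ζ i).2
  rw [MonoidHom.mem_ker, Units.ext_iff] at h
  simpa [EllWeight.coeff] using h

/-- An ℓ-weight is determined by its coefficients, which are arbitrary. -/
theorem bijective_ellWeight_coeff :
    Function.Bijective fun (ζ : EllWeight m n) (q : Fin (m + n) × ℕ) => ζ.coeff q.1 (q.2 + 1) := by
  constructor
  · intro ζ ξ h
    funext i
    refine Subtype.ext (Units.ext (PowerSeries.ext fun r => ?_))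
    rcases r with _ | r
    · exact (ζ.coeff_zero i).trans (ξ.coeff_zero i).symm
    · exact congrFun h (i, r)
  · intro χ
    let s (i : Fin (m + n)) : ℂ⟦X⟧ := 1 + PowerSeries.X * PowerSeries.mk fun r => χ (i, r)
    refine ⟨fun i => ⟨⟨s i, (s i)⁻¹, PowerSeries.mul_inv_cancel _ (by simp [s]),
      PowerSeries.inv_mul_cancel _ (by simp [s])⟩, ?_⟩, ?_⟩
    · rw [MonoidHom.mem_ker, Units.ext_iff]
      simp [s]
    · funext ⟨i, r⟩
      simp [EllWeight.coeff, s, PowerSeries.coeff_one, PowerSeries.coeff_succ_X_mul]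

theorem coeff_mul_linearSeries_succ (f : EllSeries) (c : ℂ) (p : ℕ) :
    PowerSeries.coeff (p + 1) ((f * linearSeries c : EllSeries) : (ℂ⟦X⟧)ˣ).val =
      PowerSeries.coeff (p + 1) (f : (ℂ⟦X⟧)ˣ).val - c * PowerSeries.coeff p (f : (ℂ⟦X⟧)ˣ).val := by
  change PowerSeries.coeff (p + 1) ((f : (ℂ⟦X⟧)ˣ).val * (1 - PowerSeries.C c * PowerSeries.X)) = _
  rw [mul_sub, mul_one, map_sub, ← mul_assoc, PowerSeries.coeff_succ_mul_X, PowerSeries.coeff_mul_C,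
    mul_comm c]

theorem mul_linearSeries_eq {ζ ξ : EllWeight m n} {j : Fin (m + n)} {b c : ℂ}
    (h : ∀ p, ζ.coeff j (p + 1) - b * ζ.coeff j p = ξ.coeff j (p + 1) - c * ξ.coeff j p) :
    ζ j * linearSeries b = ξ j * linearSeries c := by
  refine Subtype.ext (Units.ext (PowerSeries.ext fun r => ?_))
  rcases r with _ | r
  · exact (EllWeight.coeff_zero (m := m) (n := n) (fun _ => ζ j * linearSeries b) j).trans
      (EllWeight.coeff_zero (m := m) (n := n) (fun _ => ξ j * linearSeries c) j).symm
  · rw [coeff_mul_linearSeries_succ, coeff_mul_linearSeries_succ]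
    exact h r

variable {V : Type*} [AddCommGroup V] [Module ℂ V]
  (ρ : Yangian m n →ₐ[ℂ] Module.End ℂ V)

theorem commute_rho_d (i j : Fin (m + n)) (r s : ℕ) :
    Commute (ρ (d m n i r)) (ρ (d m n j s)) := (commute_d m n i j r s).map ρ

theorem x_rel (σ : ℤˣ) (i : ℕ) (hi : i + 1 < m + n) (j : Fin (m + n)) (r s : ℕ) :
    d m n j (r + 1) * x m n σ i hi (s + 1) - x m n σ i hi (s + 1) * d m n j (r + 1) -
      (d m n j r * x m n σ i hi (s + 2) - x m n σ i hi (s + 2) * d m n j r) =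
    (((σ : ℤ) : ℂ) * form m n (simpleRoot m n i hi) (eps m n j)) •
      if σ = 1 then d m n j r * x m n σ i hi (s + 1) else x m n σ i hi (s + 1) * d m n j r := by
  rcases Int.units_eq_one_or σ with rfl | rfl
  · simpa using x_one_rel m n i hi j r s
  · rw [if_neg (by decide)]
    simpa using x_neg_one_rel m n i hi j r s

theorem projectionOnto_map {p q : Submodule ℂ V} (h : IsCompl p q) {f : Module.End ℂ V}
    (hp : ∀ v ∈ p, f v ∈ p) (hq : ∀ v ∈ q, f v ∈ q) (v : V) :
    p.projectionOnto q h (f v) = f.restrict hp (p.projectionOnto q h v) := by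
  obtain ⟨y, hy, z, hz, rfl⟩ := Submodule.mem_sup.1 (h.sup_eq_top ▸ Submodule.mem_top (x := v))
  rw [map_add, map_add, map_add, Submodule.projectionOnto_apply_of_mem_left h hy,
    Submodule.projectionOnto_apply_of_mem_left h (hp y hy),
    Submodule.projectionOnto_apply_of_mem_right h hz,
    Submodule.projectionOnto_apply_of_mem_right h (hq z hz), add_zero, add_zero]
  rfl

variable [FiniteDimensional ℂ V]

theorem ellWeightSpace_eq (ζ : EllWeight m n) :
    ellWeightSpace ρ ζ = ⨅ q : Fin (m + n) × ℕ,
      (ρ (d m n q.1 (q.2 + 1))).maxGenEigenspace (ζ.coeff q.1 (q.2 + 1)) := by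
  rw [iInf_prod]
  simp only [ellWeightSpace, Module.End.maxGenEigenspace_eq_genEigenspace_finrank,
    Module.End.genEigenspace_nat]

theorem mapsTo_ellWeightSpace (ζ : EllWeight m n) (i : Fin (m + n)) (r : ℕ) :
    ∀ v ∈ ellWeightSpace ρ ζ, ρ (d m n i r) v ∈ ellWeightSpace ρ ζ := by
  intro v hv
  rw [ellWeightSpace_eq, Submodule.mem_iInf] at hv ⊢
  exact fun q => Module.End.mapsTo_maxGenEigenspace_of_comm (commute_rho_d ρ _ _ _ _) _ (hv q)

theorem mapsTo_ellWeightCompl (ζ : EllWeight m n) (i : Fin (m + n)) (r : ℕ) :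
    ∀ v ∈ ellWeightCompl ρ ζ, ρ (d m n i r) v ∈ ellWeightCompl ρ ζ := by
  suffices ellWeightCompl ρ ζ ≤ (ellWeightCompl ρ ζ).comap (ρ (d m n i r)) from this
  refine iSup₂_le fun ξ hξ v hv => ?_
  exact (le_iSup₂ (f := fun (ξ : EllWeight m n) (_ : ξ ≠ ζ) => ellWeightSpace ρ ξ) ξ hξ)
    (mapsTo_ellWeightSpace ρ ξ i r v hv)

/-- Joint generalized eigenspaces of commuting operators over `ℂ` are independent and span. Every
family of joint eigenvalues is the coefficient family of exactly one ℓ-weight, so the ℓ-weights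
index all of them. -/
theorem isCompl_ellWeightSpace (ζ : EllWeight m n) :
    IsCompl (ellWeightSpace ρ ζ) (ellWeightCompl ρ ζ) := by
  let F : (Fin (m + n) × ℕ → ℂ) → Submodule ℂ V := fun χ =>
    ⨅ q : Fin (m + n) × ℕ, (ρ (d m n q.1 (q.2 + 1))).maxGenEigenspace (χ q)
  have hF (ξ : EllWeight m n) : ellWeightSpace ρ ξ = F fun q => ξ.coeff q.1 (q.2 + 1) :=
    ellWeightSpace_eq ρ ξ
  have hind : iSupIndep F :=
    Module.End.independent_iInf_maxGenEigenspace_of_forall_mapsTo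
      (fun q : Fin (m + n) × ℕ => ρ (d m n q.1 (q.2 + 1)))
      fun _ _ => Module.End.mapsTo_maxGenEigenspace_of_comm (commute_rho_d ρ _ _ _ _)
  have htop : ⨆ χ, F χ = ⊤ :=
    Module.End.iSup_iInf_maxGenEigenspace_eq_top_of_forall_mapsTo
      (fun q : Fin (m + n) × ℕ => ρ (d m n q.1 (q.2 + 1)))
      (fun _ _ => Module.End.mapsTo_maxGenEigenspace_of_comm (commute_rho_d ρ _ _ _ _))
      fun _ => Module.End.iSup_maxGenEigenspace_eq_top _
  have hbij := bijective_ellWeight_coeff (m := m) (n := n)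
  constructor
  · have := hind.comp hbij.1 ζ
    simp only [ellWeightCompl, hF]
    exact this
  · rw [codisjoint_iff, eq_top_iff, ← htop, ← hbij.2.iSup_comp]
    refine iSup_le fun ξ => ?_
    rw [← hF]
    by_cases h : ξ = ζ
    · subst h; exact le_sup_left
    · exact (le_iSup₂ (f := fun (ξ : EllWeight m n) (_ : ξ ≠ ζ) => ellWeightSpace ρ ξ) ξ h).trans
        le_sup_right

theorem isNilpotent_restrict_d (ζ : EllWeight m n) (i : Fin (m + n)) (r : ℕ) :
    IsNilpotent ((ρ (d m n i r)).restrict (mapsTo_ellWeightSpace ρ ζ i r) - ζ.coeff i r • 1) := by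
  rcases r with _ | r
  · refine ⟨1, LinearMap.ext fun v => Subtype.ext ?_⟩
    simp [d_zero, EllWeight.coeff_zero]
  · refine ⟨Module.finrank ℂ V, LinearMap.ext fun v => Subtype.ext ?_⟩
    have hm : ∀ v ∈ ellWeightSpace ρ ζ,
        (ρ (d m n i (r + 1)) - ζ.coeff i (r + 1) • 1) v ∈ ellWeightSpace ρ ζ := fun v hv =>
      Submodule.sub_mem _ (mapsTo_ellWeightSpace ρ ζ i _ v hv) (Submodule.smul_mem _ _ hv)
    have e : (ρ (d m n i (r + 1))).restrict (mapsTo_ellWeightSpace ρ ζ i (r + 1)) -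
        ζ.coeff i (r + 1) • 1 = (ρ (d m n i (r + 1)) - ζ.coeff i (r + 1) • 1).restrict hm := rfl
    rw [e, Module.End.pow_restrict _ hm]
    have hv := v.2
    exact (Submodule.mem_iInf _).1 ((Submodule.mem_iInf _).1 hv i) r

end EllWeights

end SuperYangian

end

/-! ### Proof of the proposition -/

theorem mainTheorem8 (m n : ℕ) {V : Type*} [AddCommGroup V] [Module ℂ V] [FiniteDimensional ℂ V]
    (ρ : SuperYangian.Yangian m n →ₐ[ℂ] Module.End ℂ V)
    (i : ℕ) (hi : i + 1 < m + n) (σ : ℤˣ) (μ ν : SuperYangian.EllWeight m n)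
    (h : ∃ j : ℕ, 1 ≤ j ∧
      (SuperYangian.ellWeightSpace ρ μ).map (ρ (SuperYangian.x m n σ i hi j)) ⊓
        SuperYangian.ellWeightSpace ρ ν ≠ ⊥) :
    ∃ a : ℂ, ν = μ * SuperYangian.simpleEllRoot m n i hi a ^ (σ : ℤ) ∧
      ∃ hν : IsCompl (SuperYangian.ellWeightSpace ρ ν) (SuperYangian.ellWeightCompl ρ ν),
      ∃ (v : Module.Basis (Fin (Module.finrank ℂ (SuperYangian.ellWeightSpace ρ μ))) ℂ
          (SuperYangian.ellWeightSpace ρ μ))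
        (w : Module.Basis (Fin (Module.finrank ℂ (SuperYangian.ellWeightSpace ρ ν))) ℂ
          (SuperYangian.ellWeightSpace ρ ν))
        (P : Fin (Module.finrank ℂ (SuperYangian.ellWeightSpace ρ μ)) →
          Fin (Module.finrank ℂ (SuperYangian.ellWeightSpace ρ ν)) → Polynomial ℂ),
        (∀ k l, (P k l).natDegree ≤ (k : ℕ) + (l : ℕ)) ∧
        ∀ k, ∀ r : ℕ,
          Submodule.projection (SuperYangian.ellWeightSpace ρ ν)
              (SuperYangian.ellWeightCompl ρ ν) hν
              (ρ (SuperYangian.x m n σ i hi r) (v k : V)) =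
            ∑ l, PowerSeries.coeff r
              (Polynomial.aeval SuperYangian.dz (P k l) (SuperYangian.pole a)) • (w l : V) := by
  open SuperYangian in
  have hν := isCompl_ellWeightSpace ρ ν
  let π := (ellWeightSpace ρ ν).projectionOnto (ellWeightCompl ρ ν) hν
  let X : ℕ → ellWeightSpace ρ μ →ₗ[ℂ] ellWeightSpace ρ ν := fun s =>
    π ∘ₗ ρ (x m n σ i hi (s + 1)) ∘ₗ (ellWeightSpace ρ μ).subtype
  let A : Fin (m + n) → ℕ → Module.End ℂ (ellWeightSpace ρ μ) := fun j p =>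
    (ρ (d m n j p)).restrict (mapsTo_ellWeightSpace ρ μ j p)
  let B : Fin (m + n) → ℕ → Module.End ℂ (ellWeightSpace ρ ν) := fun j p =>
    (ρ (d m n j p)).restrict (mapsTo_ellWeightSpace ρ ν j p)
  let c : Fin (m + n) → ℂ := fun j => ((σ : ℤ) : ℂ) * form m n (simpleRoot m n i hi) (eps m n j)
  have hπ (j p) (v : V) : π (ρ (d m n j p) v) = B j p (π v) :=
    projectionOnto_map hν (mapsTo_ellWeightSpace ρ ν j p) (mapsTo_ellWeightCompl ρ ν j p) v
  have hcomm (ζ : EllWeight m n) (j p k q) :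
      Commute ((ρ (d m n j p)).restrict (mapsTo_ellWeightSpace ρ ζ j p))
        ((ρ (d m n k q)).restrict (mapsTo_ellWeightSpace ρ ζ k q)) :=
    LinearMap.ext fun v => Subtype.ext
      (congrArg (fun F : Module.End ℂ V => F v) (commute_rho_d ρ j k p q).eq)
  have hone (ζ : EllWeight m n) (j) :
      (ρ (d m n j 0)).restrict (mapsTo_ellWeightSpace ρ ζ j 0) = 1 :=
    LinearMap.ext fun v => Subtype.ext (by simp [d_zero])
  have hrel (j p s) : B j (p + 1) ∘ₗ X s - X s ∘ₗ A j (p + 1) -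
      (B j p ∘ₗ X (s + 1) - X (s + 1) ∘ₗ A j p) =
        -- The projection onto `V_ν` commutes with the `d_{j,p}`, so the relations of the Yangian
        -- descend to the blocks.
        c j • if σ = 1 then B j p ∘ₗ X s else X s ∘ₗ A j p := by
    have h1 := congrArg (fun F => ρ F) (x_rel σ i hi j p s)
    ext1 v
    have h2 := congrArg (fun F : Module.End ℂ V => π (F v)) h1
    split_ifs at h2 ⊢ <;>
      simp only [map_sub, map_mul, map_smul, LinearMap.sub_apply, LinearMap.smul_apply,
        Module.End.mul_apply, hπ] at h2 <;> exact h2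
  have hσ : ((σ : ℤ) : ℂ) ≠ 0 := by
    rcases Int.units_eq_one_or σ with rfl | rfl <;> simp
  have hc : c ⟨i, i.lt_succ_self.trans hi⟩ ≠ 0 := by
    refine mul_ne_zero hσ ?_
    rw [form_simpleRoot_eps, if_pos rfl]
    exact pow_ne_zero _ (by norm_num)
  -- The given nonzero vector of the image already lies in `V_ν`, where the projection is the
  -- identity.
  have hX : ∃ s, X s ≠ 0 := by
    obtain ⟨j, hj, hne⟩ := h
    obtain ⟨y, hy, hy0⟩ := (Submodule.ne_bot_iff _).1 hne
    obtain ⟨⟨v, hv, rfl⟩, hyν⟩ := hy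
    obtain ⟨s, rfl⟩ := Nat.exists_eq_add_of_le' hj
    refine ⟨s, fun h0 => hy0 ?_⟩
    have := congrArg (fun F : ellWeightSpace ρ μ →ₗ[ℂ] ellWeightSpace ρ ν => F ⟨v, hv⟩) h0
    have := congrArg Subtype.val (this.symm.trans
      (Submodule.projectionOnto_apply_of_mem_left hν hyν))
    exact this.symm
  obtain ⟨a, ha, v, w, P, hdeg, hP0, hP⟩ := exists_pole (σ = 1) (hcomm μ) (hcomm ν) (hone μ)
    (hone ν) (fun j p => isNilpotent_restrict_d ρ μ j p)
    (fun j p => isNilpotent_restrict_d ρ ν j p) hrel hc hX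
  refine ⟨a, ?_, hν, v, w, P, hdeg, fun k r => ?_⟩
  -- With `c = (α_i, ε_j)` the eigenvalue identity says `ν_j(u) (u - a - c) = μ_j(u) (u - a)` for
  -- the sign `+` and `ν_j(u) (u - a) = μ_j(u) (u - a - c)` for the sign `-`.
  · funext j
    rcases Int.units_eq_one_or σ with rfl | rfl
    · rw [Units.val_one, zpow_one, Pi.mul_apply, simpleEllRoot, ← mul_div_assoc,
        eq_div_iff_mul_eq']
      refine mul_linearSeries_eq fun p => ?_
      have := ha j p
      simp only [c, if_true, Units.val_one, Int.cast_one, one_mul] at this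
      linear_combination this
    · rw [Units.val_neg, Units.val_one, zpow_neg_one, Pi.mul_apply, Pi.inv_apply, simpleEllRoot,
        inv_div, ← mul_div_assoc, eq_div_iff_mul_eq']
      refine mul_linearSeries_eq fun p => ?_
      have := ha j p
      simp only [c, if_neg (show (-1 : ℤˣ) ≠ 1 by decide), Units.val_neg, Units.val_one,
        Int.cast_neg, Int.cast_one] at this
      linear_combination this
  · rcases r with _ | r
    -- `X_s` encodes the coefficient of `z^{-(s+1)}`; at `z^0` both sides have no term.
    · rw [x_zero]
      simp only [hP0, zero_smul, Finset.sum_const_zero, map_zero, LinearMap.zero_apply]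
    · have := congrArg Subtype.val (hP k r)
      simp only [AddSubmonoidClass.coe_finsetSum, Submodule.coe_smul] at this
      exact this
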